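/- **Setting.** Let $\mathcal V\subset(\mathbb C^2)^{\otimes n}$ be a code subspace of dimension $2^k$, $k<n$, with projector $\mathcal P$. Let $\bar X_i,\bar Z_i$ ($i\le k$) be Hermitian logical Pauli generators: they satisfy the relations of the $k$-qubit Pauli matrices on the whole space and commute with $\mathcal P$. Let $\bar P$ range over the $4^k$ logical Pauli operators they generate (with sign $+1$, $\bar Y_i=i\bar X_i\bar Z_i$). Let $\{E_l,\mathbb I-E_l\}$ be finitely many two-outcome measurements, with probabilities $p_l$, such that $\mathrm{Tr}(E_l\sigma)=1$ for every state $\sigma$ supported on $\mathcal V$. Put $\Omega=\sum_l p_lE_l$, with eigenvalues $\lambda_1\ge\dots\ge\lambda_{2^n}$, and $\Delta_{\min}=1-\lambda_{2^k+1}$, $\Delta_{\max}=1-\lambda_{2^n}$. Let $0<\epsilon<1$, $0<\delta<1/2$, and let $\tau>0$ satisfy $\tau\Delta_{\max}<\Delta_{\min}$. Put $r=\Delta_{\min}/(\tau\Delta_{\max})$, $\tilde\epsilon=\Delta_{\min}\epsilon$, $p_0=\ln r\big/\big(\ln r+\ln\frac{1-\tilde\epsilon/r}{1-\tilde\epsilon}\big)$,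 and $D[p\|q]=p\ln\frac pq+(1-p)\ln\frac{1-p}{1-q}$. Let $|\psi\rangle\in\mathcal V$ be any unit vector and $\rho$ any $n$-qubit state. **Protocol** (every measurement uses a fresh copy of $\rho$). 1. *Subspace verification.* Perform $N_1=\big\lceil \ln(1/\delta)/D[p_0\|1-\tilde\epsilon]\big\rceil$ tests, each with a measurement $\{E_l,\mathbb I-E_l\}$ drawn with probability $p_l$; let $N_{\rm pass}$ be the number of outcomes $E_l$. The verification is passed if $N_{\rm pass}\ge p_0N_1$. 2. *Direct fidelity estimation.* Draw $L=\lceil 8/(\epsilon^2\delta)\rceil$ independent logical Paulis $\bar P_1,\dots,\bar P_L$ from $p(\bar P)=2^{-k}\,\mathrm{Tr}(\bar P|\psi\rangle\langle\psi|)^2$. Measure $\bar P_i$ on $m_i=\big\lceil \delta\ln(4/\delta)/(2^kp(\bar P_i))\big\rceil$ copies, with outcomes $a_{ij}=\pm1$, and set $$Y=\frac1L\sum_{i=1}^{L}\frac{1}{\mathrm{Tr}(\bar P_i|\psi\rangle\langle\psi|)}\cdot\frac1{m_i}\sum_{j=1}^{m_i}a_{ij},\qquad N_2=\sum_{i=1}^{L}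 m_i .$$ **Theorem.** The outcomes of the protocol follow a probability distribution (in particular $\sum_{\bar P}p(\bar P)=1$), and if the verification is passed, then $\mathrm{Tr}(|\psi\rangle\langle\psi|\rho)\ge Y-2\epsilon$ holds with confidence $1-2\delta$, in the sense that $$\Pr\big(N_{\rm pass}\ge p_0N_1\ \text{ and }\ \mathrm{Tr}(|\psi\rangle\langle\psi|\rho)\le Y-2\epsilon\big)\le 2\delta .$$ The sample complexity is $$N_1=O\!\left(\frac{\ln(1/\delta)}{\Delta_{\min}\,\epsilon}\right),\qquad \mathbb E[N_2]=O\!\left(\frac1{\epsilon^2\delta}+\frac{2^k\ln(1/\delta)}{\epsilon^2}\right),$$ where the first constant depends only on $r$ and the second one is absolute. -/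

import Mathlib

open scoped Matrix BigOperators ComplexOrder

noncomputable section

/-- Operators on the Hilbert space of `n` qubits, as matrices in the computational basis. -/
abbrev Op (n : ℕ) : Type := Matrix (Fin n → Fin 2) (Fin n → Fin 2) ℂ

/-- Density matrices. -/
def IsState {n : ℕ} (ρ : Op n) : Prop := ρ.PosSemidef ∧ ρ.trace = 1

/-- `Tr (A ρ)`; its real part is taken only to land in `ℝ`, since it is used for Hermitian `A`. -/
def expect {n : ℕ} (A ρ : Op n) : ℝ := (A * ρ).trace.re

/-- The rank-one operator `|ψ⟩⟨ψ|`. -/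
def ketbra {n : ℕ} (ψ : (Fin n → Fin 2) → ℂ) : Op n := Matrix.vecMulVec ψ (star ψ)

/-- A quantum code on `n` physical and `k < n` logical qubits: a subspace of dimension `2 ^ k`,
given by its orthogonal projector, with logical Pauli generators `X i`, `Z i`. The generators are
operators on the whole space that satisfy the relations of the Pauli matrices of `k` qubits and
leave the code subspace invariant. This includes all stabilizer codes with their usual logical
Pauli operators, and codes that are not stabilizer codes. -/
structure QubitCode (n k : ℕ) where
  k_lt_n : k < n
  proj : Op n
  proj_isHermitian : proj.IsHermitian
  proj_mul_self : proj * proj = proj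
  proj_rank : proj.rank = 2 ^ k
  X : Fin k → Op n
  Z : Fin k → Op n
  X_isHermitian : ∀ i, (X i).IsHermitian
  Z_isHermitian : ∀ i, (Z i).IsHermitian
  X_mul_self : ∀ i, X i * X i = 1
  Z_mul_self : ∀ i, Z i * Z i = 1
  X_comm_X : ∀ i j, X i * X j = X j * X i
  Z_comm_Z : ∀ i j, Z i * Z j = Z j * Z i
  X_comm_Z : ∀ i j, i ≠ j → X i * Z j = Z j * X i
  X_anticomm_Z : ∀ i, X i * Z i = -(Z i * X i)
  X_comm_proj : ∀ i, X i * proj = proj * X i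
  Z_comm_proj : ∀ i, Z i * proj = proj * Z i

/-- Labels of the `4 ^ k` Pauli operators of `k` qubits (with sign `+1`): on each qubit `(x, z)`
stands for `I`, `X`, `Z` or `Y = i X Z`. -/
abbrev PauliLabel (k : ℕ) : Type := Fin k → Bool × Bool

/-- The logical Pauli operator with a given label. -/
def QubitCode.logicalPauli {n k : ℕ} (C : QubitCode n k) (P : PauliLabel k) : Op n :=
  ((List.finRange k).map fun i =>
    match P i with
    | (false, false) => (1 : Op n)
    | (true, false) => C.X i
    | (false, true) => C.Z i
    | (true, true) => Complex.I • (C.X i * C.Z i)).prod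

/-! ### Subspace verification -/

/-- A verification strategy: two-outcome measurements `{E l, 1 - E l}`, the `l`-th one chosen with
probability `prob l`, such that every state in the code subspace passes each of them surely. -/
structure VerificationStrategy {n k : ℕ} (C : QubitCode n k) (M : ℕ) where
  E : Fin M → Op n
  E_nonneg : ∀ l, (E l).PosSemidef
  E_le_one : ∀ l, (1 - E l).PosSemidef
  pass_code : ∀ l (σ : Op n), IsState σ → C.proj * σ * C.proj = σ → (E l * σ).trace = 1
  prob : Fin M → ℝ
  prob_nonneg : ∀ l, 0 ≤ prob l
  prob_sum : ∑ l, prob l = 1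

namespace VerificationStrategy

variable {n k M : ℕ} {C : QubitCode n k} (S : VerificationStrategy C M)

/-- The verification operator `Ω = ∑ l, p l • E l`. -/
def omega : Op n := ∑ l, (S.prob l : ℂ) • S.E l

theorem omega_isHermitian : S.omega.IsHermitian := by
  unfold omega Matrix.IsHermitian
  rw [Matrix.conjTranspose_sum]
  refine Finset.sum_congr rfl fun l _ => ?_
  rw [Matrix.conjTranspose_smul, (S.E_nonneg l).isHermitian.eq, Complex.star_def,
    Complex.conj_ofReal]

/-- The `j`-th eigenvalue of `Ω` in descending order, with multiplicity, counted from `0`. -/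
def eigenvalue (j : ℕ) (hj : j < 2 ^ n) : ℝ :=
  S.omega_isHermitian.eigenvalues₀ ⟨j, by simpa using hj⟩

/-- `Δ_min = 1 - λ_{d_V + 1}`, with `d_V = 2 ^ k` the dimension of the code subspace. -/
def gapMin : ℝ := 1 - S.eigenvalue (2 ^ k) (Nat.pow_lt_pow_right one_lt_two C.k_lt_n)

/-- `Δ_max = 1 - λ_d`, with `d = 2 ^ n`. -/
def gapMax : ℝ := 1 - S.eigenvalue (2 ^ n - 1) (Nat.sub_lt (by positivity) one_pos)

/-- `r = Δ_min / (τ Δ_max)`. -/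
def ratio (τ : ℝ) : ℝ := S.gapMin / (τ * S.gapMax)

/-- The threshold passing frequency `p₀`. -/
def threshold (τ ε : ℝ) : ℝ :=
  Real.log (S.ratio τ) / (Real.log (S.ratio τ) +
    Real.log ((1 - S.gapMin * ε / S.ratio τ) / (1 - S.gapMin * ε)))

end VerificationStrategy

/-- Kullback–Leibler divergence of Bernoulli distributions. -/
def klBernoulli (p q : ℝ) : ℝ :=
  p * Real.log (p / q) + (1 - p) * Real.log ((1 - p) / (1 - q))

/-- The number `N₁` of verification tests: `ln (1/δ) / D[p₀ ‖ 1 - Δ_min ε]`, rounded up. -/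
def VerificationStrategy.numTests {n k M : ℕ} {C : QubitCode n k} (S : VerificationStrategy C M)
    (τ ε δ : ℝ) : ℕ :=
  ⌈Real.log (1 / δ) / klBernoulli (S.threshold τ ε) (1 - S.gapMin * ε)⌉₊

/-- A record of `N` verification tests: for each one, the chosen measurement and whether the test
was passed. -/
abbrev VerifRecord (M N : ℕ) : Type := Fin N → Fin M × Bool

/-- The probability of a record, each test being made on a fresh copy of `ρ`. -/
def VerificationStrategy.recordProb {n k M : ℕ} {C : QubitCode n k}
    (S : VerificationStrategy C M) (ρ : Op n) {N : ℕ} (a : VerifRecord M N) : ℝ :=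
  ∏ t, S.prob (a t).1 *
    (if (a t).2 then expect (S.E (a t).1) ρ else expect (1 - S.E (a t).1) ρ)

/-- The number `N_pass` of passed tests. -/
def numPass {M N : ℕ} (a : VerifRecord M N) : ℕ :=
  (Finset.univ.filter fun t => (a t).2 = true).card

/-! ### Direct fidelity estimation on the logical qubits -/

namespace QubitCode

variable {n k : ℕ} (C : QubitCode n k) (ψ : (Fin n → Fin 2) → ℂ)

/-- The sampling probability `(Tr (P̄ |ψ⟩⟨ψ|))² / 2 ^ k` of a logical Pauli operator. -/
def samplingProb (P : PauliLabel k) : ℝ := expect (C.logicalPauli P) (ketbra ψ) ^ 2 / 2 ^ k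

/-- The number `m = δ ln (4/δ) / (2 ^ k p(P̄))`, rounded up, of measurements of a sampled logical
Pauli operator. (A `P̄` with `p(P̄) = 0` is never sampled.) -/
def numShots (δ : ℝ) (P : PauliLabel k) : ℕ :=
  ⌈δ * Real.log (4 / δ) / (2 ^ k * C.samplingProb ψ P)⌉₊

/-- A record of the estimation: the sampled logical Pauli operators and, for each of them, the
outcomes of its measurements (`true` for `+1`, `false` for `-1`). -/
abbrev DfeRecord (δ : ℝ) (l : ℕ) : Type :=
  Fin l → (P : PauliLabel k) × (Fin (C.numShots ψ δ P) → Bool)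

/-- The probability of a record, each measurement being made on a fresh copy of `ρ`. -/
def dfeProb (ρ : Op n) {δ : ℝ} {l : ℕ} (b : C.DfeRecord ψ δ l) : ℝ :=
  ∏ i, C.samplingProb ψ (b i).1 *
    ∏ j, expect ((1 / 2 : ℂ) •
      (1 + (if (b i).2 j then (1 : ℂ) else -1) • C.logicalPauli (b i).1)) ρ

/-- The estimator `Y`. The outcomes here are `±1`: the normalization `2 ^ (k/2)` of outcomes, and
the factor that compensates it, cancel. -/
def estimator {δ : ℝ} {l : ℕ} (b : C.DfeRecord ψ δ l) : ℝ :=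
  (1 / (l : ℝ)) * ∑ i, (1 / expect (C.logicalPauli (b i).1) (ketbra ψ)) *
    ((1 / (C.numShots ψ δ (b i).1 : ℝ)) * ∑ j, if (b i).2 j then (1 : ℝ) else -1)

/-- The number `N₂` of copies of `ρ` that were consumed. -/
def dfeSamples {δ : ℝ} {l : ℕ} (b : C.DfeRecord ψ δ l) : ℕ := ∑ i, C.numShots ψ δ (b i).1

end QubitCode

/-- The number `8 / (ε² δ)`, rounded up, of logical Pauli operators that are sampled. -/
def numPaulis (ε δ : ℝ) : ℕ := ⌈8 / (ε ^ 2 * δ)⌉₊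

/-! ### The composite protocol -/

/-- A record of both steps of the composite protocol. -/
abbrev ProtocolRecord {n k M : ℕ} {C : QubitCode n k} (S : VerificationStrategy C M)
    (ψ : (Fin n → Fin 2) → ℂ) (τ ε δ : ℝ) : Type :=
  VerifRecord M (S.numTests τ ε δ) × C.DfeRecord ψ δ (numPaulis ε δ)

/-- The probability of a record of the composite protocol run on copies of `ρ`. -/
def protocolProb {n k M : ℕ} {C : QubitCode n k} (S : VerificationStrategy C M)
    (ψ : (Fin n → Fin 2) → ℂ) (ρ : Op n) {τ ε δ : ℝ} (ω : ProtocolRecord S ψ τ ε δ) : ℝ :=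
  S.recordProb ρ ω.1 * C.dfeProb ψ ρ ω.2

/-- The probability of an event under given weights on a finite sample space. -/
def eventProb {α : Type*} [Fintype α] (w : α → ℝ) (A : Set α) : ℝ := ∑ ω, A.indicator w ω

end

/-! ### Independent repetitions on a finite sample space -/

section Iid

variable {β : Type*} [Fintype β] {w : β → ℝ}

/-! The state `ρ` is fixed, so its code overlap F = Tr(𝒫ρ) is either at most 1 - ε or larger, and in
each case a single step of the protocol already makes the bad event unlikely. This gives the bound
δ, hence 2δ.

If F ≤ 1 - ε, passing is unlikely. Every test accepts the code surely, so Ω fixes the code, and a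
positive gap makes the code the span of the top 2^k eigenvectors. Hence a single test is passed with
probability at most 1 - Δ_min (1 - F) ≤ 1 - Δ_min ε (`expect_omega_le`). The threshold p₀ is at
least this number, and Chernoff's bound with N₁ tests gives δ (`chernoff_bound`,
`eventProb_pass_le`).

If F > 1 - ε, overestimation is unlikely. The logical Paulis restricted to the code form an
orthogonal basis of the operators on it, so |ψ⟩⟨ψ| has a unique extension T in their span, and the
mean of Y is Tr(Tρ). Multiplication by 𝒫 is injective on that span, so T is a projector, and it
commutes with 𝒫. From (1 - T)(1 - 𝒫) ≥ 0 and T𝒫 = |ψ⟩⟨ψ|, the mean exceeds the fidelity by at most 1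
- F < ε (`sum_expect_mul_expect_le`). The bad event therefore forces Y to exceed its mean by ε, and
this deviation is split into two halves. The choice of Paulis has variance at most 1, because the
logical reduced state of `ρ` has purity at most 1 (`sum_expect_logicalPauli_sq_le`), so Chebyshev
gives δ/2. The shot noise is sub-Gaussian by Hoeffding's lemma and gives δ/4.

For N₁, p₀ is equally divergent from 1 - e and 1 - e/r with e = Δ_min ε, and the Hellinger distance
between these two bounds the divergence below by a multiple of e that depends on r only. For N₂,
rounding costs one shot per sample, and each of the 4^k Paulis adds at most δ ln(4/δ) / 2^k to the
mean number of shots. -/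

theorem sum_prod_weights (hw1 : ∑ b, w b = 1) (N : ℕ) :
    ∑ a : Fin N → β, ∏ t, w (a t) = 1 := by
  have := Finset.prod_univ_sum (fun _ : Fin N => (Finset.univ : Finset β)) (fun _ b => w b)
  rw [Fintype.piFinset_univ] at this
  rw [← this]
  simp [hw1]

theorem sum_prod_weights_mul_marginal (hw1 : ∑ b, w b = 1) {N : ℕ} (i : Fin N) (f : β → ℝ) :
    ∑ a : Fin N → β, (∏ t, w (a t)) * f (a i) = ∑ b, w b * f b := by
  -- The factor `f (a i)` is absorbed into the product as a factor that is 1 away from `i`, so that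
  -- the sum over records factorizes.
  have := Finset.prod_univ_sum (fun _ : Fin N => (Finset.univ : Finset β))
    (fun t b => w b * if t = i then f b else 1)
  rw [Fintype.piFinset_univ] at this
  calc _ = ∑ a : Fin N → β, ∏ t, (w (a t) * if t = i then f (a t) else 1) := by
        refine Finset.sum_congr rfl fun a _ => ?_
        rw [Finset.prod_mul_distrib, Finset.prod_ite_eq' Finset.univ i (fun t => f (a t))]
        simp
    _ = ∏ t : Fin N, ∑ b, (w b * if t = i then f b else 1) := this.symm
    _ = ∏ t : Fin N, if t = i then ∑ b, w b * f b else 1 := by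
        refine Finset.prod_congr rfl fun t _ => ?_
        split_ifs <;> simp [hw1]
    _ = _ := by rw [Finset.prod_ite_eq' Finset.univ i (fun _ => ∑ b, w b * f b)]; simp

theorem sum_prod_weights_mul_sum (hw1 : ∑ b, w b = 1) (N : ℕ) (f : β → ℝ) :
    ∑ a : Fin N → β, (∏ t, w (a t)) * ∑ i, f (a i) = N * ∑ b, w b * f b := by
  simp_rw [Finset.mul_sum]
  rw [Finset.sum_comm]
  simp_rw [sum_prod_weights_mul_marginal hw1, Finset.sum_const, Finset.card_univ,
    Fintype.card_fin, nsmul_eq_mul, Finset.mul_sum]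

theorem sum_prod_weights_mul_cross {g : β → ℝ} (hg : ∑ b, w b * g b = 0) {N : ℕ} {i j : Fin N}
    (hij : i ≠ j) :
    ∑ a : Fin N → β, (∏ t, w (a t)) * (g (a i) * g (a j)) = 0 := by
  have := Finset.prod_univ_sum (fun _ : Fin N => (Finset.univ : Finset β))
    (fun t b => w b * ((if t = i then g b else 1) * if t = j then g b else 1))
  rw [Fintype.piFinset_univ] at this
  calc _ = ∑ a : Fin N → β,
          ∏ t, (w (a t) * ((if t = i then g (a t) else 1) * if t = j then g (a t) else 1)) := by
        refine Finset.sum_congr rfl fun a _ => ?_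
        rw [Finset.prod_mul_distrib, Finset.prod_mul_distrib,
          Finset.prod_ite_eq' Finset.univ i (fun t => g (a t)),
          Finset.prod_ite_eq' Finset.univ j (fun t => g (a t))]
        simp
    _ = _ := this.symm
    _ = 0 := by
        refine Finset.prod_eq_zero (Finset.mem_univ i) ?_
        simp [hij, hg]

/-- Variances of independent copies add: centred cross terms vanish and only the diagonal of the
squared sum survives. -/
theorem sum_prod_weights_mul_sq {g : β → ℝ} (hw1 : ∑ b, w b = 1) (hg : ∑ b, w b * g b = 0)
    (N : ℕ) :
    ∑ a : Fin N → β, (∏ t, w (a t)) * (∑ i, g (a i)) ^ 2 = N * ∑ b, w b * g b ^ 2 := by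
  simp_rw [sq (∑ i, g _), Finset.sum_mul_sum, Finset.mul_sum]
  rw [Finset.sum_comm]
  calc _ = ∑ i : Fin N, ∑ b, w b * g b ^ 2 := by
        refine Finset.sum_congr rfl fun i _ => ?_
        rw [Finset.sum_comm, Finset.sum_eq_single i]
        · simp_rw [← sq]
          exact sum_prod_weights_mul_marginal hw1 i (fun b => g b ^ 2)
        · exact fun j _ hj => sum_prod_weights_mul_cross hg hj.symm
        · simp
    _ = _ := by simp [Finset.mul_sum]

theorem sum_prod_weights_mul_exp (N : ℕ) (f : β → ℝ) (s : ℝ) :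
    ∑ a : Fin N → β, (∏ t, w (a t)) * Real.exp (s * ∑ i, f (a i)) =
      (∑ b, w b * Real.exp (s * f b)) ^ N := by
  have := Finset.prod_univ_sum (fun _ : Fin N => (Finset.univ : Finset β))
    (fun _ b => w b * Real.exp (s * f b))
  rw [Fintype.piFinset_univ] at this
  simp only [Finset.prod_const, Finset.card_univ, Fintype.card_fin] at this
  rw [this]
  refine Finset.sum_congr rfl fun a _ => ?_
  rw [Finset.prod_mul_distrib, Finset.mul_sum, Real.exp_sum]

end Iid

/-! ### Event probabilities: Markov's inequality, the union bound, marginals -/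

section EventProb

variable {α : Type*} [Fintype α] {w : α → ℝ}

/-- Markov's inequality in the form that serves both tail bounds: `h` majorizes the indicator, and
is taken exponential or quadratic. -/
theorem eventProb_le_sum_mul (hw : ∀ a, 0 ≤ w a) {A : Set α} {h : α → ℝ} (h0 : ∀ a, 0 ≤ h a)
    (h1 : ∀ a ∈ A, 1 ≤ h a) : eventProb w A ≤ ∑ a, w a * h a := by
  refine Finset.sum_le_sum fun a _ => ?_
  by_cases ha : a ∈ A
  · rw [Set.indicator_of_mem ha]
    exact le_mul_of_one_le_right (hw a) (h1 a ha)
  · rw [Set.indicator_of_notMem ha]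
    exact mul_nonneg (hw a) (h0 a)

theorem eventProb_mono (hw : ∀ a, 0 ≤ w a) {A B : Set α} (h : A ⊆ B) :
    eventProb w A ≤ eventProb w B :=
  Finset.sum_le_sum fun a _ => Set.indicator_le_indicator_of_subset h hw a

theorem eventProb_union_le (hw : ∀ a, 0 ≤ w a) (A B : Set α) :
    eventProb w (A ∪ B) ≤ eventProb w A + eventProb w B := by
  unfold eventProb
  rw [← Finset.sum_add_distrib]
  refine Finset.sum_le_sum fun a _ => ?_
  by_cases hA : a ∈ A <;> by_cases hB : a ∈ B <;> simp [hA, hB, hw a]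

variable {γ : Type*} [Fintype γ] {v : γ → ℝ}

theorem eventProb_mul_fst (hv : ∑ c, v c = 1) (A : Set α) :
    eventProb (fun x : α × γ => w x.1 * v x.2) {x | x.1 ∈ A} = eventProb w A := by
  unfold eventProb
  rw [Fintype.sum_prod_type]
  refine Finset.sum_congr rfl fun a _ => ?_
  by_cases ha : a ∈ A
  · simp [Set.indicator, ha, ← Finset.mul_sum, hv]
  · simp [Set.indicator, ha]

theorem eventProb_mul_snd (hw : ∑ a, w a = 1) (B : Set γ) :
    eventProb (fun x : α × γ => w x.1 * v x.2) {x | x.2 ∈ B} = eventProb v B := by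
  unfold eventProb
  rw [Fintype.sum_prod_type_right]
  refine Finset.sum_congr rfl fun a _ => ?_
  by_cases ha : a ∈ B
  · simp [Set.indicator, ha, ← Finset.sum_mul, hw]
  · simp [Set.indicator, ha]

end EventProb

/-! ### Exponential and quadratic tail bounds -/

section Tails

variable {β : Type*} [Fintype β] {w : β → ℝ}

/-- The exponential Markov inequality for a sum of independent copies. -/
theorem eventProb_sum_ge_le_exp (hw : ∀ b, 0 ≤ w b) (N : ℕ) (f : β → ℝ) {s : ℝ} (hs : 0 ≤ s)
    (x : ℝ) :
    eventProb (fun a : Fin N → β => ∏ t, w (a t)) {a | x ≤ ∑ i, f (a i)} ≤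
      Real.exp (-(s * x)) * (∑ b, w b * Real.exp (s * f b)) ^ N := by
  have key := eventProb_le_sum_mul (w := fun a : Fin N → β => ∏ t, w (a t))
    (A := {a | x ≤ ∑ i, f (a i)}) (h := fun a => Real.exp (-(s * x)) * Real.exp (s * ∑ i, f (a i)))
    (fun a => Finset.prod_nonneg fun t _ => hw _) (fun a => by positivity) (fun a ha => by
      rw [← Real.exp_add, Real.one_le_exp_iff]
      have := mul_le_mul_of_nonneg_left (show x ≤ ∑ i, f (a i) from ha) hs
      linarith)
  refine key.trans (le_of_eq ?_)
  rw [← sum_prod_weights_mul_exp, Finset.mul_sum]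
  exact Finset.sum_congr rfl fun a _ => by ring

/-- The Chebyshev inequality for a sum of independent copies. -/
theorem eventProb_sum_ge_le_variance (hw : ∀ b, 0 ≤ w b) (hw1 : ∑ b, w b = 1) (N : ℕ)
    {g : β → ℝ} (hg : ∑ b, w b * g b = 0) {x : ℝ} (hx : 0 < x) :
    eventProb (fun a : Fin N → β => ∏ t, w (a t)) {a | x ≤ ∑ i, g (a i)} ≤
      N * (∑ b, w b * g b ^ 2) / x ^ 2 := by
  have key := eventProb_le_sum_mul (w := fun a : Fin N → β => ∏ t, w (a t))
    (A := {a | x ≤ ∑ i, g (a i)}) (h := fun a => (∑ i, g (a i)) ^ 2 / x ^ 2)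
    (fun a => Finset.prod_nonneg fun t _ => hw _) (fun a => by positivity) (fun a ha => by
      rw [one_le_div (by positivity)]
      exact pow_le_pow_left₀ hx.le ha 2)
  refine key.trans (le_of_eq ?_)
  rw [← sum_prod_weights_mul_sq hw1 hg, Finset.sum_div]
  exact Finset.sum_congr rfl fun a _ => by ring

end Tails

/-! ### Bernoulli divergences and the threshold -/

section Kl

/-- This is `log y ≤ y - 1` at y = √(q/p). Added over both outcomes, the left sides make up the
squared Hellinger distance. -/
theorem mul_log_div_ge {p q : ℝ} (hp : 0 < p) (hq : 0 < q) :
    2 * p - 2 * (√p * √q) ≤ p * Real.log (p / q) := by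
  have h := Real.log_le_sub_one_of_pos (x := √q / √p) (by positivity)
  rw [Real.log_div (by positivity) (by positivity), Real.log_sqrt hq.le, Real.log_sqrt hp.le] at h
  rw [Real.log_div hp.ne' hq.ne']
  have h2 : p * (√q / √p) = √p * √q := by
    nth_rewrite 1 [← Real.mul_self_sqrt hp.le]
    field_simp
  nlinarith [mul_le_mul_of_nonneg_left h hp.le]

/-- The divergence dominates the squared Hellinger distance, hence the part of the latter that
comes from one of the two outcomes. -/
theorem klBernoulli_ge_sq {p q : ℝ} (hp : 0 < p) (hp1 : p < 1) (hq : 0 < q) (hq1 : q < 1) :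
    (√(1 - p) - √(1 - q)) ^ 2 ≤ klBernoulli p q := by
  have h1 := mul_log_div_ge hp hq
  have h2 := mul_log_div_ge (sub_pos.2 hp1) (sub_pos.2 hq1)
  have h3 := sq_nonneg (√p - √q)
  have := Real.sq_sqrt hp.le
  have := Real.sq_sqrt hq.le
  have := Real.sq_sqrt (sub_pos.2 hp1).le
  have := Real.sq_sqrt (sub_pos.2 hq1).le
  unfold klBernoulli
  nlinarith

theorem klBernoulli_nonneg {p q : ℝ} (hp : 0 < p) (hp1 : p < 1) (hq : 0 < q) (hq1 : q < 1) :
    0 ≤ klBernoulli p q :=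
  (sq_nonneg _).trans (klBernoulli_ge_sq hp hp1 hq hq1)

variable {r e : ℝ}

/-- The threshold at which the divergences from `1 - e` and from `1 - e / r` agree. -/
noncomputable def balancedThreshold (r e : ℝ) : ℝ :=
  Real.log r / (Real.log r + Real.log ((1 - e / r) / (1 - e)))

theorem balancedThreshold_bounds (hr : 1 < r) (he : 0 < e) (he1 : e < 1) :
    0 < balancedThreshold r e ∧ balancedThreshold r e < 1 ∧ 1 - e ≤ balancedThreshold r e ∧
      balancedThreshold r e * Real.log ((1 - e / r) / (1 - e)) =
        (1 - balancedThreshold r e) * Real.log r := by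
  have hr0 : 0 < r := by linarith
  have her : e / r < e := div_lt_self he hr
  have hA : 0 < Real.log r := Real.log_pos hr
  have hB : 0 < Real.log ((1 - e / r) / (1 - e)) := by
    apply Real.log_pos
    rw [one_lt_div (by linarith)]
    linarith
  -- Nonnegativity of this divergence is exactly the inequality that places the threshold above `1 -
  -- e`.
  have hkl := klBernoulli_nonneg (p := 1 - e) (q := 1 - e / r) (by linarith) (by linarith)
    (by linarith) (by have : 0 < e / r := by positivity
                      linarith)
  have hD : klBernoulli (1 - e) (1 - e / r) =
      e * Real.log r - (1 - e) * Real.log ((1 - e / r) / (1 - e)) := by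
    unfold klBernoulli
    rw [show 1 - (1 - e) = e by ring, show 1 - (1 - e / r) = e / r by ring,
      show e / (e / r) = r by field_simp,
      ← inv_div (1 - e / r) (1 - e), Real.log_inv]
    ring
  rw [hD] at hkl
  unfold balancedThreshold
  set A := Real.log r
  set B := Real.log ((1 - e / r) / (1 - e))
  refine ⟨by positivity, ?_, ?_, ?_⟩
  · rw [div_lt_one (by positivity)]
    linarith
  · rw [le_div_iff₀ (by positivity)]
    linarith
  · field_simp
    ring

theorem klBernoulli_balancedThreshold_eq (hr : 1 < r) (he : 0 < e) (he1 : e < 1) :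
    klBernoulli (balancedThreshold r e) (1 - e) =
      klBernoulli (balancedThreshold r e) (1 - e / r) := by
  obtain ⟨h0, h1, -, hbal⟩ := balancedThreshold_bounds hr he he1
  have hr0 : 0 < r := by linarith
  have her : e / r < e := div_lt_self he hr
  have her0 : 0 < e / r := by positivity
  rw [Real.log_div (by linarith) (by linarith)] at hbal
  unfold klBernoulli
  rw [Real.log_div h0.ne' (by linarith), Real.log_div h0.ne' (by linarith),
    Real.log_div (by linarith) (by linarith), Real.log_div (by linarith) (by linarith),
    show 1 - (1 - e) = e by ring, show 1 - (1 - e / r) = e / r by ring,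
    Real.log_div he.ne' hr0.ne']
  linarith

/-- The divergence from `1 - e` equals that from `1 - e / r`, so it dominates the squared distances
of x = √(1 - p₀) from both √e and √(e/r). The larger of these is at least a quarter of (√e -
√(e/r))². -/
theorem klBernoulli_balancedThreshold_ge (hr : 1 < r) (he : 0 < e) (he1 : e < 1) :
    e * (1 - 1 / √r) ^ 2 / 4 ≤ klBernoulli (balancedThreshold r e) (1 - e) := by
  obtain ⟨h0, h1, -, -⟩ := balancedThreshold_bounds hr he he1
  have hr0 : 0 < r := by linarith
  have her : e / r < e := div_lt_self he hr
  have her0 : 0 < e / r := by positivity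
  have k1 := klBernoulli_ge_sq h0 h1 (q := 1 - e) (by linarith) (by linarith)
  have k2 := klBernoulli_ge_sq h0 h1 (q := 1 - e / r) (by linarith) (by linarith)
  rw [← klBernoulli_balancedThreshold_eq hr he he1] at k2
  rw [show 1 - (1 - e) = e by ring] at k1
  rw [show 1 - (1 - e / r) = e / r by ring] at k2
  have h3 : e * (1 - 1 / √r) ^ 2 = (√e - √(e / r)) ^ 2 := by
    rw [Real.sqrt_div he.le]
    nth_rewrite 1 [← Real.sq_sqrt he.le]
    ring
  rw [h3]
  set x := √(1 - balancedThreshold r e)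
  nlinarith [sq_nonneg ((x - √e) + (x - √(e / r)))]

theorem klBernoulli_balancedThreshold_pos (hr : 1 < r) (he : 0 < e) (he1 : e < 1) :
    0 < klBernoulli (balancedThreshold r e) (1 - e) := by
  refine lt_of_lt_of_le ?_ (klBernoulli_balancedThreshold_ge hr he he1)
  have : 1 / √r < 1 := by
    rw [div_lt_one (by positivity), Real.lt_sqrt zero_le_one]
    simpa
  have : 0 < 1 - 1 / √r := by linarith
  positivity

/-- The Chernoff bound for the number of successes among independent trials. -/
theorem chernoff_bound {β : Type*} [Fintype β] {w : β → ℝ} (hw : ∀ b, 0 ≤ w b)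
    (hw1 : ∑ b, w b = 1) (B : β → Bool) {p q : ℝ} (hq : 0 < q) (hqp : q ≤ p) (hp1 : p < 1)
    (hB : ∑ b, w b * (if B b then 1 else 0) ≤ q) (N : ℕ) :
    eventProb (fun a : Fin N → β => ∏ t, w (a t))
        {a | p * N ≤ ∑ i, if B (a i) then (1 : ℝ) else 0} ≤
      Real.exp (-(N * klBernoulli p q)) := by
  have hp : 0 < p := hq.trans_le hqp
  -- The optimal tilt: it turns success probability `q` into `p`.
  set s := Real.log (p * (1 - q) / (q * (1 - p))) with hs_def
  have hpq : 0 < p * (1 - q) / (q * (1 - p)) := by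
    apply div_pos <;> apply mul_pos <;> linarith
  have hexp : Real.exp s = p * (1 - q) / (q * (1 - p)) := Real.exp_log hpq
  have hge : 1 ≤ p * (1 - q) / (q * (1 - p)) := by
    rw [one_le_div (mul_pos hq (by linarith))]
    nlinarith
  have hs : 0 ≤ s := Real.log_nonneg hge
  refine (eventProb_sum_ge_le_exp hw N (fun b => if B b then (1 : ℝ) else 0) hs (p * N)).trans ?_
  -- Since `s ≥ 0`, the moment generating function increases with the success probability, so its
  -- value at `q` is an upper bound.
  have hmgf : ∑ b, w b * Real.exp (s * if B b then 1 else 0) ≤ (1 - q) / (1 - p) := by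
    have : ∀ b, w b * Real.exp (s * if B b then 1 else 0) =
        w b + (Real.exp s - 1) * (w b * if B b then 1 else 0) := by
      intro b
      split_ifs
      · simp
        ring
      · simp
    simp_rw [this]
    rw [Finset.sum_add_distrib, ← Finset.mul_sum, hw1]
    have h1 : (Real.exp s - 1) * ∑ b, w b * (if B b then 1 else 0) ≤ (Real.exp s - 1) * q :=
      mul_le_mul_of_nonneg_left hB (by rw [hexp]; linarith)
    refine (add_le_add_right h1 1).trans (le_of_eq ?_)
    rw [hexp]
    have : 1 - p ≠ 0 := by linarith
    field_simp
    ring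
  have h0 : 0 ≤ ∑ b, w b * Real.exp (s * if B b then 1 else 0) :=
    Finset.sum_nonneg fun b _ => mul_nonneg (hw b) (Real.exp_pos _).le
  have hq1 : 0 < 1 - q := by linarith
  have hp1' : 0 < 1 - p := by linarith
  refine (mul_le_mul_of_nonneg_left (pow_le_pow_left₀ h0 hmgf N) (Real.exp_pos _).le).trans
    (le_of_eq ?_)
  rw [← Real.exp_log (div_pos hq1 hp1'), ← Real.exp_nat_mul, ← Real.exp_add]
  congr 1
  unfold klBernoulli
  rw [hs_def, Real.log_div (by positivity) (by positivity), Real.log_mul hp.ne' hq1.ne',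
    Real.log_mul hq.ne' hp1'.ne', Real.log_div hp.ne' hq.ne', Real.log_div hp1'.ne' hq1.ne',
    Real.log_div hq1.ne' hp1'.ne']
  ring

end Kl

open MeasureTheory in
/-- The Hoeffding lemma for an outcome `±1` with mean `x`. -/
theorem hoeffding_two_point {x : ℝ} (hx : -1 ≤ x) (hx1 : x ≤ 1) (s : ℝ) :
    (1 + x) / 2 * Real.exp (s * (1 - x)) + (1 - x) / 2 * Real.exp (s * (-1 - x)) ≤
      Real.exp (s ^ 2 / 2) := by
  set μ : Measure Bool := ENNReal.ofReal ((1 + x) / 2) • Measure.dirac true +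
    ENNReal.ofReal ((1 - x) / 2) • Measure.dirac false with hμ
  have : IsProbabilityMeasure μ := ⟨by
    simp only [hμ, Measure.coe_add, Measure.coe_smul, Pi.add_apply, Pi.smul_apply, measure_univ,
      smul_eq_mul, mul_one]
    rw [← ENNReal.ofReal_add (by linarith) (by linarith), ← ENNReal.ofReal_one]
    congr 1
    ring⟩
  have hint : ∀ f : Bool → ℝ, ∫ b, f b ∂μ = (1 + x) / 2 * f true + (1 - x) / 2 * f false := by
    intro f
    rw [hμ, integral_add_measure (Integrable.of_finite.smul_measure ENNReal.ofReal_ne_top)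
        (Integrable.of_finite.smul_measure ENNReal.ofReal_ne_top), integral_smul_measure,
      integral_smul_measure, integral_dirac, integral_dirac,
      ENNReal.toReal_ofReal (by linarith), ENNReal.toReal_ofReal (by linarith)]
    rfl
  have h := (ProbabilityTheory.hasSubgaussianMGF_of_mem_Icc_of_integral_eq_zero (μ := μ)
    (X := fun b => (if b then 1 else -1) - x) (a := -1 - x) (b := 1 - x)
    (by fun_prop) (.of_forall fun b => by cases b <;> simp)
    (by rw [hint]; simp; ring)).mgf_le s
  rw [ProbabilityTheory.mgf, hint] at h
  simp only [if_true, Bool.false_eq_true, if_false] at h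
  -- The outcomes lie in an interval of length 2, so the variance proxy is (2/2)² = 1.
  refine h.trans (le_of_eq ?_)
  congr 1
  simp
  norm_num

/-! ### Traces of positive semidefinite matrices -/

namespace Matrix

variable {m : Type*} [Fintype m]

open scoped MatrixOrder in
theorem PosSemidef.trace_mul_nonneg [DecidableEq m] {A B : Matrix m m ℂ} (hA : A.PosSemidef)
    (hB : B.PosSemidef) : 0 ≤ (A * B).trace := by
  obtain ⟨X, rfl⟩ := CStarAlgebra.nonneg_iff_eq_star_mul_self.mp hA.nonneg
  rw [star_eq_conjTranspose, mul_assoc, trace_mul_comm]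
  exact (hB.mul_mul_conjTranspose_same X).trace_nonneg

/-- The 2 × 2 principal minors are nonnegative; summing them over all index pairs gives the bound.
-/
theorem PosSemidef.trace_mul_self_le {A : Matrix m m ℂ} (hA : A.PosSemidef) :
    (A * A).trace ≤ A.trace ^ 2 := by
  have h : ∀ i j, A i j * A j i ≤ A i i * A j j := by
    intro i j
    have := (hA.submatrix ![i, j]).det_nonneg
    rw [det_fin_two] at this
    simpa using this
  simp only [trace, diag_apply, mul_apply, sq, Finset.sum_mul_sum]
  exact Finset.sum_le_sum fun i _ => Finset.sum_le_sum fun j _ => h i j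

theorem IsHermitian.posSemidef_of_mul_self {A : Matrix m m ℂ} (hA : A.IsHermitian)
    (h : A * A = A) : A.PosSemidef := by
  have := posSemidef_conjTranspose_mul_self A
  rwa [hA.eq, h] at this

/-- The rank factorization. -/
theorem exists_mul_eq_of_rank [DecidableEq m] (A : Matrix m m ℂ) :
    ∃ (B : Matrix m (Fin A.rank) ℂ) (D : Matrix (Fin A.rank) m ℂ), B * D = A := by
  let b : Module.Basis (Fin A.rank) ℂ (LinearMap.range A.mulVecLin) := Module.finBasis _ _
  refine ⟨of fun i j => (b j : m → ℂ) i,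
    of fun j i => b.repr (A.mulVecLin.rangeRestrict (Pi.single i 1)) j, ?_⟩
  ext i i'
  have h := congrArg (fun v : LinearMap.range A.mulVecLin => (v : m → ℂ) i)
    (b.sum_repr (A.mulVecLin.rangeRestrict (Pi.single i' 1)))
  simp only [mul_apply, of_apply]
  simp only [AddSubmonoidClass.coe_finsetSum, Finset.sum_apply, Submodule.coe_smul,
    Pi.smul_apply, smul_eq_mul, LinearMap.codRestrict_apply, LinearMap.rangeRestrict,
    mulVecLin_apply, mulVec_single_one] at h
  simp_rw [mul_comm] at h ⊢
  exact h

theorem trace_eq_rank_of_mul_self [DecidableEq m] {A : Matrix m m ℂ} (h : A * A = A) :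
    A.trace = A.rank := by
  have hp : LinearMap.IsProj (LinearMap.range (toLin' A)) (toLin' A) := by
    refine ⟨fun x => ⟨x, rfl⟩, ?_⟩
    rintro _ ⟨y, rfl⟩
    rw [← LinearMap.comp_apply, ← toLin'_mul, h]
  have := hp.trace
  rw [trace_toLin'_eq] at this
  rw [this]
  rfl

end Matrix

/-! ### Expectations and rank-one operators -/

theorem trace_mul_eq_expect {n : ℕ} {A B : Op n} (hA : A.IsHermitian) (hB : B.IsHermitian) :
    (A * B).trace = (expect A B : ℂ) := by
  have : star (A * B).trace = (A * B).trace := by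
    rw [← Matrix.trace_conjTranspose, Matrix.conjTranspose_mul, hA.eq, hB.eq,
      Matrix.trace_mul_comm]
  exact (Complex.conj_eq_iff_re.1 this).symm

theorem expect_nonneg {n : ℕ} {A ρ : Op n} (hA : A.PosSemidef) (hρ : IsState ρ) :
    0 ≤ expect A ρ :=
  (Complex.le_def.1 (hA.trace_mul_nonneg hρ.1)).1

theorem expect_one {n : ℕ} {ρ : Op n} (hρ : IsState ρ) : expect 1 ρ = 1 := by
  simp [expect, hρ.2]

theorem expect_add {n : ℕ} (A B ρ : Op n) : expect (A + B) ρ = expect A ρ + expect B ρ := by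
  simp [expect, add_mul]

theorem expect_sub {n : ℕ} (A B ρ : Op n) : expect (A - B) ρ = expect A ρ - expect B ρ := by
  simp [expect, sub_mul]

theorem expect_smul {n : ℕ} (c : ℝ) (A ρ : Op n) :
    expect ((c : ℂ) • A) ρ = c * expect A ρ := by
  simp [expect]

theorem expect_sum {n : ℕ} {ι : Type*} (s : Finset ι) (A : ι → Op n) (ρ : Op n) :
    expect (∑ i ∈ s, A i) ρ = ∑ i ∈ s, expect (A i) ρ := by
  simp [expect, Finset.sum_mul, Matrix.trace_sum]

theorem ketbra_posSemidef {n : ℕ} (v : (Fin n → Fin 2) → ℂ) : (ketbra v).PosSemidef :=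
  Matrix.posSemidef_vecMulVec_self_star v

theorem trace_mul_ketbra {n : ℕ} (A : Op n) (v : (Fin n → Fin 2) → ℂ) :
    (A * ketbra v).trace = star v ⬝ᵥ (A *ᵥ v) := by
  rw [ketbra, Matrix.mul_vecMulVec, Matrix.trace_vecMulVec, dotProduct_comm]

theorem mul_ketbra_of_mulVec {n : ℕ} {A : Op n} {v : (Fin n → Fin 2) → ℂ} (h : A *ᵥ v = v) :
    A * ketbra v = ketbra v := by
  rw [ketbra, Matrix.mul_vecMulVec, h]

theorem ketbra_mul_of_mulVec {n : ℕ} {A : Op n} {v : (Fin n → Fin 2) → ℂ} (hA : A.IsHermitian)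
    (h : A *ᵥ v = v) : ketbra v * A = ketbra v := by
  have := congrArg Matrix.conjTranspose (mul_ketbra_of_mulVec h)
  rwa [Matrix.conjTranspose_mul, hA.eq, (ketbra_posSemidef v).isHermitian.eq] at this

theorem ketbra_mul_self {n : ℕ} (v : (Fin n → Fin 2) → ℂ) :
    ketbra v * ketbra v = (star v ⬝ᵥ v) • ketbra v := by
  rw [ketbra, Matrix.vecMulVec_mul_vecMulVec]
  ext i j
  simp [Matrix.vecMulVec_apply, Matrix.smul_apply]
  ring

/-! ### Products over lists of distinct indices -/

/-- Operators do not commute, so logical Paulis are ordered products. Commutation between distinct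
sites reduces their algebra to one site at a time. -/
theorem List.prod_map_mul_of_commute {ι M : Type*} [Monoid M] {f g : ι → M}
    (h : ∀ i j, i ≠ j → Commute (f i) (g j)) {l : List ι} (hl : l.Nodup) :
    (l.map f).prod * (l.map g).prod = (l.map fun i => f i * g i).prod := by
  induction l with
  | nil => simp
  | cons a l ih =>
    rw [List.nodup_cons] at hl
    have hc : Commute (l.map f).prod (g a) := by
      refine Commute.list_prod_left _ _ fun x hx => ?_
      obtain ⟨i, hi, rfl⟩ := List.mem_map.1 hx
      exact h i a (by rintro rfl; exact hl.1 hi)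
    simp only [List.map_cons, List.prod_cons]
    rw [← ih hl.2, mul_assoc, ← mul_assoc _ (g a), hc.eq]
    simp only [mul_assoc]

theorem List.prod_map_smul_fun {ι R A : Type*} [CommSemiring R] [Semiring A] [Algebra R A]
    (c : ι → R) (f : ι → A) (l : List ι) :
    (l.map fun i => c i • f i).prod = (l.map c).prod • (l.map f).prod := by
  induction l with
  | nil => simp
  | cons a l ih => simp [ih, smul_smul, mul_comm]

theorem List.prod_map_isHermitian {ι : Type*} {m : Type*} [Fintype m] [DecidableEq m]
    {f : ι → Matrix m m ℂ} (h : ∀ i j, i ≠ j → Commute (f i) (f j))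
    (hf : ∀ i, (f i).IsHermitian) {l : List ι} (hl : l.Nodup) : (l.map f).prod.IsHermitian := by
  induction l with
  | nil => simp
  | cons a l ih =>
    rw [List.nodup_cons] at hl
    have hc : Commute (l.map f).prod (f a) := by
      refine Commute.list_prod_left _ _ fun x hx => ?_
      obtain ⟨i, hi, rfl⟩ := List.mem_map.1 hx
      exact h i a (by rintro rfl; exact hl.1 hi)
    simp only [List.map_cons, List.prod_cons]
    rw [Matrix.IsHermitian, Matrix.conjTranspose_mul, (ih hl.2).eq, (hf a).eq, hc.eq]

/-! ### The logical Pauli operators -/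

namespace QubitCode

variable {n k : ℕ} (C : QubitCode n k)

/-- The factor of a logical Pauli operator on a single logical qubit. -/
noncomputable def pauliFactor (i : Fin k) (a : Bool × Bool) : Op n :=
  match a with
  | (false, false) => (1 : Op n)
  | (true, false) => C.X i
  | (false, true) => C.Z i
  | (true, true) => Complex.I • (C.X i * C.Z i)

theorem logicalPauli_eq (P : PauliLabel k) :
    C.logicalPauli P = ((List.finRange k).map fun i => C.pauliFactor i (P i)).prod := rfl

theorem Z_mul_X (i : Fin k) : C.Z i * C.X i = -(C.X i * C.Z i) := by
  rw [C.X_anticomm_Z, neg_neg]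

theorem X_mul_X_mul (i : Fin k) (A : Op n) : C.X i * (C.X i * A) = A := by
  rw [← mul_assoc, C.X_mul_self, one_mul]

theorem Z_mul_X_mul (i : Fin k) (A : Op n) : C.Z i * (C.X i * A) = -(C.X i * (C.Z i * A)) := by
  rw [← mul_assoc, C.Z_mul_X, neg_mul, mul_assoc]

theorem pauliFactor_commute_of {i : Fin k} {A : Op n} (hx : Commute (C.X i) A)
    (hz : Commute (C.Z i) A) (a : Bool × Bool) : Commute (C.pauliFactor i a) A := by
  rcases a with ⟨_ | _, _ | _⟩
  exacts [Commute.one_left A, hz, hx, (hx.mul_left hz).smul_left Complex.I]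

theorem pauliFactor_commute {i j : Fin k} (hij : i ≠ j) (a b : Bool × Bool) :
    Commute (C.pauliFactor i a) (C.pauliFactor j b) :=
  C.pauliFactor_commute_of
    (C.pauliFactor_commute_of (C.X_comm_X j i) (C.X_comm_Z i j hij).symm b).symm
    (C.pauliFactor_commute_of (C.X_comm_Z j i hij.symm) (C.Z_comm_Z j i) b).symm a

theorem pauliFactor_commute_proj (i : Fin k) (a : Bool × Bool) :
    Commute (C.pauliFactor i a) C.proj :=
  C.pauliFactor_commute_of (C.X_comm_proj i) (C.Z_comm_proj i) a

theorem pauliFactor_isHermitian (i : Fin k) (a : Bool × Bool) :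
    (C.pauliFactor i a).IsHermitian := by
  rcases a with ⟨_ | _, _ | _⟩ <;> simp only [pauliFactor]
  · exact Matrix.isHermitian_one
  · exact C.Z_isHermitian i
  · exact C.X_isHermitian i
  · rw [Matrix.IsHermitian, Matrix.conjTranspose_smul, Matrix.conjTranspose_mul,
      (C.X_isHermitian i).eq, (C.Z_isHermitian i).eq, C.Z_mul_X]
    simp

theorem pauliFactor_mul_self (i : Fin k) (a : Bool × Bool) :
    C.pauliFactor i a * C.pauliFactor i a = 1 := by
  rcases a with ⟨_ | _, _ | _⟩ <;>
    simp [pauliFactor, mul_assoc, smul_smul, C.X_mul_self, C.Z_mul_self, C.Z_mul_X_mul]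

/-- Only closure up to a phase is needed later; the phase itself never matters. -/
theorem exists_pauliFactor_mul (i : Fin k) (a b : Bool × Bool) :
    ∃ c : ℂ, C.pauliFactor i a * C.pauliFactor i b =
      c • C.pauliFactor i (a.1 ^^ b.1, a.2 ^^ b.2) := by
  rcases a with ⟨_ | _, _ | _⟩ <;> rcases b with ⟨_ | _, _ | _⟩ <;>
    simp only [pauliFactor, Bool.xor_false, Bool.xor_true, Bool.not_false, Bool.not_true,
      mul_assoc, smul_smul, C.X_mul_self, C.Z_mul_self, C.Z_mul_X, C.X_mul_X_mul,
      C.Z_mul_X_mul, mul_neg, neg_neg, mul_one, one_mul, smul_mul_assoc, mul_smul_comm,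
      Complex.I_mul_I, neg_smul, one_smul, smul_neg] <;>
    first
      | (refine ⟨1, ?_⟩; simp; done)
      | (refine ⟨-1, ?_⟩; simp; done)
      | (refine ⟨Complex.I, ?_⟩; simp; done)
      | (refine ⟨-Complex.I, ?_⟩; simp)

/-- The sign by which two Pauli operators on one qubit commute. -/
noncomputable def pauliSign (a b : Bool × Bool) : ℂ :=
  if (a.1 && b.2) ^^ (a.2 && b.1) then -1 else 1

theorem pauliFactor_mul_comm (i : Fin k) (a b : Bool × Bool) :
    C.pauliFactor i a * C.pauliFactor i b =
      pauliSign a b • (C.pauliFactor i b * C.pauliFactor i a) := by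
  rcases a with ⟨_ | _, _ | _⟩ <;> rcases b with ⟨_ | _, _ | _⟩ <;>
    simp [pauliFactor, pauliSign, mul_assoc, C.X_mul_self, C.Z_mul_self, C.Z_mul_X,
      C.Z_mul_X_mul]

theorem logicalPauli_isHermitian (P : PauliLabel k) : (C.logicalPauli P).IsHermitian :=
  List.prod_map_isHermitian (fun _ _ hij => C.pauliFactor_commute hij _ _)
    (fun i => C.pauliFactor_isHermitian i _) (List.nodup_finRange k)

theorem logicalPauli_mul_self (P : PauliLabel k) :
    C.logicalPauli P * C.logicalPauli P = 1 := by
  rw [logicalPauli_eq, List.prod_map_mul_of_commute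
    (fun _ _ hij => C.pauliFactor_commute hij _ _) (List.nodup_finRange k)]
  simp [pauliFactor_mul_self]

theorem logicalPauli_commute_proj (P : PauliLabel k) : Commute (C.logicalPauli P) C.proj := by
  refine Commute.list_prod_left _ _ fun x hx => ?_
  obtain ⟨i, -, rfl⟩ := List.mem_map.1 hx
  exact C.pauliFactor_commute_proj i (P i)

theorem exists_logicalPauli_mul (P Q : PauliLabel k) :
    ∃ c : ℂ, C.logicalPauli P * C.logicalPauli Q =
      c • C.logicalPauli fun i => ((P i).1 ^^ (Q i).1, (P i).2 ^^ (Q i).2) := by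
  choose c hc using fun i => C.exists_pauliFactor_mul i (P i) (Q i)
  refine ⟨((List.finRange k).map c).prod, ?_⟩
  rw [logicalPauli_eq, logicalPauli_eq, List.prod_map_mul_of_commute
    (fun _ _ hij => C.pauliFactor_commute hij _ _) (List.nodup_finRange k), logicalPauli_eq,
    ← List.prod_map_smul_fun]
  simp_rw [hc]

theorem logicalPauli_mul_comm (P Q : PauliLabel k) :
    C.logicalPauli P * C.logicalPauli Q =
      (∏ i, pauliSign (P i) (Q i)) • (C.logicalPauli Q * C.logicalPauli P) := by
  simp only [logicalPauli_eq]
  rw [List.prod_map_mul_of_commute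
    (fun _ _ hij => C.pauliFactor_commute hij _ _) (List.nodup_finRange k),
    List.prod_map_mul_of_commute
    (fun _ _ hij => C.pauliFactor_commute hij _ _) (List.nodup_finRange k),
    ← List.prod_ofFn, List.ofFn_eq_map, ← List.prod_map_smul_fun]
  simp_rw [← pauliFactor_mul_comm]

theorem logicalPauli_one : C.logicalPauli (fun _ => (false, false)) = 1 := by
  simp [logicalPauli_eq, pauliFactor]

theorem trace_proj : C.proj.trace = 2 ^ k := by
  rw [Matrix.trace_eq_rank_of_mul_self C.proj_mul_self, C.proj_rank]
  norm_cast

/-- Some logical Pauli `Q` anticommutes with `R`. Conjugation by `Q` preserves the trace and fixes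
the projector, but flips the sign of `R`. -/
theorem trace_logicalPauli_mul_proj {R : PauliLabel k} (hR : R ≠ fun _ => (false, false)) :
    (C.logicalPauli R * C.proj).trace = 0 := by
  obtain ⟨i, hi⟩ := Function.ne_iff.1 hR
  have hex : ∃ b, pauliSign (R i) b = -1 := by
    revert hi
    rcases R i with ⟨_ | _, _ | _⟩
    · simp
    · exact fun _ => ⟨(true, false), by simp [pauliSign]⟩
    · exact fun _ => ⟨(false, true), by simp [pauliSign]⟩
    · exact fun _ => ⟨(false, true), by simp [pauliSign]⟩
  obtain ⟨b, hb⟩ := hex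
  -- `Q` acts on site `i` alone, where it anticommutes with the nontrivial factor of `R`.
  let Q : PauliLabel k := Function.update (fun _ => (false, false)) i b
  have hanti : C.logicalPauli R * C.logicalPauli Q = -(C.logicalPauli Q * C.logicalPauli R) := by
    rw [logicalPauli_mul_comm, Finset.prod_eq_single i]
    · simp [Q, hb]
    · intro j _ hj
      simp [Q, hj, pauliSign]
    · simp
  have h : (C.logicalPauli R * C.proj).trace = -(C.logicalPauli R * C.proj).trace := by
    calc (C.logicalPauli R * C.proj).trace
        = (C.logicalPauli Q * (C.logicalPauli Q * (C.logicalPauli R * C.proj))).trace := by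
          rw [← mul_assoc (C.logicalPauli Q), C.logicalPauli_mul_self, one_mul]
      _ = (C.logicalPauli Q * C.logicalPauli R * (C.proj * C.logicalPauli Q)).trace := by
          rw [Matrix.trace_mul_comm]
          simp only [mul_assoc]
      _ = (-(C.logicalPauli R * C.logicalPauli Q) * (C.logicalPauli Q * C.proj)).trace := by
          rw [hanti, neg_neg, (C.logicalPauli_commute_proj Q).eq]
      _ = _ := by
          rw [neg_mul, Matrix.trace_neg, mul_assoc, ← mul_assoc (C.logicalPauli Q),
            C.logicalPauli_mul_self, one_mul]
  exact self_eq_neg.1 h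

end QubitCode

/-! ### Operators on the code and their logical extensions -/

namespace QubitCode

variable {n k : ℕ} (C : QubitCode n k)

theorem trace_logicalPauli_mul_logicalPauli_mul_proj (P Q : PauliLabel k) :
    (C.logicalPauli Q * (C.logicalPauli P * C.proj)).trace = if P = Q then 2 ^ k else 0 := by
  split_ifs with h
  · rw [h, ← mul_assoc, C.logicalPauli_mul_self, one_mul, C.trace_proj]
  · obtain ⟨c, hc⟩ := C.exists_logicalPauli_mul Q P
    rw [← mul_assoc, hc, smul_mul_assoc, Matrix.trace_smul, trace_logicalPauli_mul_proj, smul_zero]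
    intro h0
    refine h (funext fun i => ?_)
    have := congrFun h0 i
    simp only [Prod.mk.injEq, bne_eq_false_iff_eq] at this
    exact Prod.ext this.1.symm this.2.symm

theorem eq_zero_of_sum_smul_logicalPauli_mul_proj {c : PauliLabel k → ℂ}
    (h : ∑ P, c P • (C.logicalPauli P * C.proj) = 0) (Q : PauliLabel k) : c Q = 0 := by
  have := congrArg (fun A => (C.logicalPauli Q * A).trace) h
  simpa [Finset.mul_sum, Matrix.trace_sum, trace_logicalPauli_mul_logicalPauli_mul_proj] using this

/-- The logical Pauli operators, restricted to the code subspace, span the operators on it. -/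
theorem mem_span_logicalPauli_mul_proj {A : Op n} (hA : C.proj * A * C.proj = A) :
    A ∈ Submodule.span ℂ (Set.range fun P => C.logicalPauli P * C.proj) := by
  -- With 𝒫 = BD, every operator on the code has the form BMD with M of size 2^k. Their dimension is
  -- thus at most 4^k, the number of linearly independent restricted Paulis.
  obtain ⟨B, D, hBD⟩ := Matrix.exists_mul_eq_of_rank C.proj
  let R : Matrix (Fin C.proj.rank) (Fin C.proj.rank) ℂ →ₗ[ℂ] Op n :=
    { toFun := fun M => B * M * D
      map_add' := fun M N => by rw [Matrix.mul_add, Matrix.add_mul]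
      map_smul' := fun c M => by simp }
  have hR : ∀ A : Op n, C.proj * A * C.proj = A → A ∈ LinearMap.range R := by
    intro A hA
    refine ⟨D * A * B, ?_⟩
    change B * (D * A * B) * D = A
    rw [← hBD] at hA
    simpa only [Matrix.mul_assoc] using hA
  have hle : Submodule.span ℂ (Set.range fun P => C.logicalPauli P * C.proj) ≤
      LinearMap.range R := by
    rw [Submodule.span_le]
    rintro _ ⟨P, rfl⟩
    refine hR _ ?_
    change C.proj * (C.logicalPauli P * C.proj) * C.proj = C.logicalPauli P * C.proj
    rw [mul_assoc, mul_assoc, C.proj_mul_self, ← mul_assoc, ← (C.logicalPauli_commute_proj P).eq,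
      mul_assoc, C.proj_mul_self]
  have hli : LinearIndependent ℂ fun P => C.logicalPauli P * C.proj :=
    Fintype.linearIndependent_iff.2 fun c hc =>
      C.eq_zero_of_sum_smul_logicalPauli_mul_proj hc
  have hcard : Module.finrank ℂ (LinearMap.range R) ≤
      Module.finrank ℂ (Submodule.span ℂ (Set.range fun P => C.logicalPauli P * C.proj)) := by
    rw [finrank_span_eq_card hli]
    refine (LinearMap.finrank_range_le R).trans (le_of_eq ?_)
    rw [Module.finrank_matrix]
    simp only [Fintype.card_fin, C.proj_rank, Module.finrank_self, mul_one, Fintype.card_pi,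
      Fintype.card_prod, Fintype.card_bool, Finset.prod_const, Finset.card_univ]
    rw [← mul_pow]
  rw [Submodule.eq_of_le_of_finrank_le hle hcard]
  exact hR A hA

/-- The combination of logical Pauli operators that agrees with `A` on the code subspace. -/
noncomputable def lift (A : Op n) : Op n :=
  ∑ P, ((2 ^ k : ℂ)⁻¹ * (C.logicalPauli P * A).trace) • C.logicalPauli P

theorem lift_mul_proj {A : Op n} (hA : C.proj * A * C.proj = A) : C.lift A * C.proj = A := by
  obtain ⟨c, hc⟩ :=
    (Submodule.mem_span_range_iff_exists_fun ℂ).1 (C.mem_span_logicalPauli_mul_proj hA)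
  have hcQ : ∀ Q, (C.logicalPauli Q * A).trace = c Q * 2 ^ k := by
    intro Q
    rw [← hc]
    simp [Finset.mul_sum, Matrix.trace_sum, trace_logicalPauli_mul_logicalPauli_mul_proj]
  rw [lift, Finset.sum_mul]
  refine Eq.trans (Finset.sum_congr rfl fun P _ => ?_) hc
  rw [hcQ, smul_mul_assoc, mul_comm (c P), inv_mul_cancel_left₀ (by positivity)]

/-- The algebra of logical operators. -/
def logicalSpan : Submodule ℂ (Op n) := Submodule.span ℂ (Set.range C.logicalPauli)

theorem lift_mem (A : Op n) : C.lift A ∈ C.logicalSpan :=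
  Submodule.sum_mem _ fun P _ => Submodule.smul_mem _ _ (Submodule.subset_span ⟨P, rfl⟩)

theorem mul_mem_logicalSpan {A B : Op n} (hA : A ∈ C.logicalSpan) (hB : B ∈ C.logicalSpan) :
    A * B ∈ C.logicalSpan := by
  have h : C.logicalSpan * C.logicalSpan ≤ C.logicalSpan := by
    unfold logicalSpan
    rw [Submodule.span_mul_span, Submodule.span_le]
    rintro _ ⟨_, ⟨P, rfl⟩, _, ⟨Q, rfl⟩, rfl⟩
    obtain ⟨c, hc⟩ := C.exists_logicalPauli_mul P Q
    simp only [hc]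
    exact Submodule.smul_mem _ _ (Submodule.subset_span ⟨_, rfl⟩)
  exact h (Submodule.mul_mem_mul hA hB)

theorem eq_zero_of_mul_proj_eq_zero {A : Op n} (hA : A ∈ C.logicalSpan) (h : A * C.proj = 0) :
    A = 0 := by
  obtain ⟨c, rfl⟩ := (Submodule.mem_span_range_iff_exists_fun ℂ).1 hA
  simp only [Finset.sum_mul, smul_mul_assoc] at h
  simp [C.eq_zero_of_sum_smul_logicalPauli_mul_proj h]

theorem lift_isHermitian {A : Op n} (hA : A.IsHermitian) : (C.lift A).IsHermitian := by
  rw [Matrix.IsHermitian, lift, Matrix.conjTranspose_sum]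
  refine Finset.sum_congr rfl fun P _ => ?_
  rw [Matrix.conjTranspose_smul, (C.logicalPauli_isHermitian P).eq,
    trace_mul_eq_expect (C.logicalPauli_isHermitian P) hA]
  simp

theorem lift_commute_proj (A : Op n) : Commute (C.lift A) C.proj :=
  Commute.sum_left _ _ _ fun P _ => (C.logicalPauli_commute_proj P).smul_left _

/-- The right side is symmetric in `A` and `B`, so `lift` is self-adjoint for the trace pairing and
can be moved from one factor to the other. -/
theorem trace_lift_mul (A B : Op n) :
    (C.lift A * B).trace =
      (2 ^ k : ℂ)⁻¹ * ∑ P, (C.logicalPauli P * A).trace * (C.logicalPauli P * B).trace := by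
  rw [lift, Finset.sum_mul, Matrix.trace_sum, Finset.mul_sum]
  refine Finset.sum_congr rfl fun P _ => ?_
  rw [smul_mul_assoc, Matrix.trace_smul, smul_eq_mul, mul_assoc]

variable {v : (Fin n → Fin 2) → ℂ}

theorem proj_mul_ketbra_mul_proj (hv : C.proj *ᵥ v = v) :
    C.proj * ketbra v * C.proj = ketbra v := by
  rw [mul_ketbra_of_mulVec hv, ketbra_mul_of_mulVec C.proj_isHermitian hv]

/-- The identity holds after multiplication by the projector, where the lift becomes `ketbra v`.
Both sides lie in the logical algebra, on which that multiplication is injective. -/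
theorem lift_ketbra_mul_self (hv : C.proj *ᵥ v = v) :
    C.lift (ketbra v) * C.lift (ketbra v) = (star v ⬝ᵥ v) • C.lift (ketbra v) := by
  have h := C.lift_mul_proj (C.proj_mul_ketbra_mul_proj hv)
  rw [← sub_eq_zero]
  refine C.eq_zero_of_mul_proj_eq_zero (Submodule.sub_mem _
    (C.mul_mem_logicalSpan (C.lift_mem _) (C.lift_mem _))
    (Submodule.smul_mem _ _ (C.lift_mem _))) ?_
  rw [sub_mul, mul_assoc, smul_mul_assoc, h]
  have h2 : C.lift (ketbra v) * ketbra v = C.lift (ketbra v) * C.proj * ketbra v := by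
    rw [mul_assoc, mul_ketbra_of_mulVec hv]
  rw [h2, h, ketbra_mul_self, sub_self]

theorem lift_ketbra_posSemidef (hv : C.proj *ᵥ v = v) : (C.lift (ketbra v)).PosSemidef := by
  by_cases h0 : v = 0
  · have : C.lift (ketbra v) = 0 := by simp [lift, ketbra, h0]
    rw [this]
    exact Matrix.PosSemidef.zero
  -- The lift T satisfies T*T = ‖v‖² T, so T is a positive multiple of T*T.
  · have hpos : 0 < star v ⬝ᵥ v := Matrix.dotProduct_star_self_pos_iff.2 h0
    have hH := C.lift_isHermitian (ketbra_posSemidef v).isHermitian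
    have h := Matrix.posSemidef_conjTranspose_mul_self (C.lift (ketbra v))
    rw [hH.eq, C.lift_ketbra_mul_self hv] at h
    have h2 := h.smul (inv_nonneg.2 hpos.le)
    rwa [smul_smul, inv_mul_cancel₀ hpos.ne', one_smul] at h2

/-! ### First and second moments of logical Pauli expectations -/

variable {ψ : (Fin n → Fin 2) → ℂ} {ρ : Op n}

/-- Parseval's identity on the code, applied to a pure state; it normalizes the sampling
distribution. -/
theorem sum_expect_logicalPauli_sq (hψ : C.proj *ᵥ ψ = ψ) (h1 : star ψ ⬝ᵥ ψ = 1) :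
    ∑ P, expect (C.logicalPauli P) (ketbra ψ) ^ 2 = 2 ^ k := by
  have h := C.trace_lift_mul (ketbra ψ) (ketbra ψ)
  have h2 : (C.lift (ketbra ψ) * ketbra ψ).trace = 1 := by
    nth_rewrite 2 [← mul_ketbra_of_mulVec hψ]
    rw [← mul_assoc, C.lift_mul_proj (C.proj_mul_ketbra_mul_proj hψ), trace_mul_ketbra, ketbra,
      Matrix.vecMulVec_mulVec, h1]
    simp [h1]
  rw [h2] at h
  simp_rw [trace_mul_eq_expect (C.logicalPauli_isHermitian _) (ketbra_posSemidef ψ).isHermitian,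
    ← sq] at h
  have h3 : (2 ^ k : ℂ) = ∑ P, (expect (C.logicalPauli P) (ketbra ψ) : ℂ) ^ 2 := by
    rw [← mul_one (2 ^ k : ℂ), h, mul_inv_cancel_left₀ (by positivity)]
  exact_mod_cast h3.symm

theorem sum_expect_mul_expect_le (hψ : C.proj *ᵥ ψ = ψ) (h1 : star ψ ⬝ᵥ ψ = 1)
    (hρ : IsState ρ) :
    (∑ P, expect (C.logicalPauli P) (ketbra ψ) * expect (C.logicalPauli P) ρ) / 2 ^ k ≤
      expect (ketbra ψ) ρ + (1 - expect C.proj ρ) := by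
  have hT := C.lift_isHermitian (ketbra_posSemidef ψ).isHermitian
  have hTT := C.lift_ketbra_mul_self hψ
  rw [h1, one_smul] at hTT
  have hTP := C.lift_mul_proj (C.proj_mul_ketbra_mul_proj hψ)
  have hPT := (C.lift_commute_proj (ketbra ψ)).eq
  have hexp := C.trace_lift_mul (ketbra ψ) ρ
  simp_rw [trace_mul_eq_expect (C.logicalPauli_isHermitian _) (ketbra_posSemidef ψ).isHermitian,
    trace_mul_eq_expect (C.logicalPauli_isHermitian _) hρ.1.isHermitian,
    trace_mul_eq_expect hT hρ.1.isHermitian] at hexp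
  have hexp' : expect (C.lift (ketbra ψ)) ρ =
      (∑ P, expect (C.logicalPauli P) (ketbra ψ) * expect (C.logicalPauli P) ρ) / 2 ^ k := by
    rw [div_eq_inv_mul]
    refine Complex.ofReal_injective ?_
    push_cast
    exact hexp
  rw [← hexp']
  set T := C.lift (ketbra ψ)
  -- The operator is (1 - T)(1 - 𝒫), a product of commuting projectors, because T𝒫 = |ψ⟩⟨ψ|.
  have hG : (1 - T - C.proj + ketbra ψ).PosSemidef := by
    refine Matrix.IsHermitian.posSemidef_of_mul_self
      (((Matrix.isHermitian_one.sub hT).sub C.proj_isHermitian).add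
        (ketbra_posSemidef ψ).isHermitian) ?_
    have hc : Commute (1 - T) (1 - C.proj) :=
      (Commute.one_left _).sub_left ((Commute.one_right _).sub_right hPT)
    have e : 1 - T - C.proj + ketbra ψ = (1 - T) * (1 - C.proj) := by
      rw [← hTP]
      noncomm_ring
    have e1 : (1 - T) * (1 - T) = 1 - T := by
      rw [mul_sub, sub_mul, sub_mul, hTT]
      simp
    have e2 : (1 - C.proj) * (1 - C.proj) = 1 - C.proj := by
      rw [mul_sub, sub_mul, sub_mul, C.proj_mul_self]
      simp
    rw [e, hc.symm.mul_mul_mul_comm, e1, e2]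
  have := expect_nonneg hG hρ
  rw [expect_add, expect_sub, expect_sub, expect_one hρ] at this
  linarith

/-- `ρ` need not be supported on the code. The operator `D` on the code with the same logical
expectations is a state, and the sum is 2^k times its purity. -/
theorem sum_expect_logicalPauli_sq_le (hρ : IsState ρ) :
    ∑ P, expect (C.logicalPauli P) ρ ^ 2 ≤ 2 ^ k := by
  set D : Op n := ∑ P, ((2 ^ k : ℂ)⁻¹ * (C.logicalPauli P * ρ).trace) •
    (C.logicalPauli P * C.proj) with hD
  have hDl : D = C.lift ρ * C.proj := by
    rw [hD, lift, Finset.sum_mul]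
    simp_rw [smul_mul_assoc]
  have hDH : D.IsHermitian := by
    rw [hDl, Matrix.IsHermitian, Matrix.conjTranspose_mul, C.proj_isHermitian.eq,
      (C.lift_isHermitian hρ.1.isHermitian).eq, (C.lift_commute_proj ρ).eq]
  have hDpos : D.PosSemidef := by
    -- Self-adjointness of `lift` turns the quadratic form of `D` into the expectation in `ρ` of the
    -- lift of a rank-one operator, which is positive.
    refine Matrix.PosSemidef.of_dotProduct_mulVec_nonneg hDH fun w => ?_
    set v := C.proj *ᵥ w with hv
    have hPv : C.proj *ᵥ v = v := by rw [hv, Matrix.mulVec_mulVec, C.proj_mul_self]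
    have hDp : D = C.proj * C.lift ρ * C.proj := by
      rw [hDl, ← (C.lift_commute_proj ρ).eq, mul_assoc, C.proj_mul_self]
    have : star w ⬝ᵥ D *ᵥ w = (C.lift (ketbra v) * ρ).trace := by
      calc star w ⬝ᵥ D *ᵥ w = star v ⬝ᵥ C.lift ρ *ᵥ v := by
            rw [hDp, ← Matrix.mulVec_mulVec, ← Matrix.mulVec_mulVec, Matrix.dotProduct_mulVec,
              hv, Matrix.star_mulVec, C.proj_isHermitian.eq]
        _ = (C.lift ρ * ketbra v).trace := (trace_mul_ketbra _ _).symm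
        _ = _ := by
            rw [trace_lift_mul, trace_lift_mul]
            simp_rw [mul_comm]
    rw [this]
    exact (C.lift_ketbra_posSemidef hPv).trace_mul_nonneg hρ.1
  have hQ : ∀ Q, (C.logicalPauli Q * D).trace = (C.logicalPauli Q * ρ).trace := by
    intro Q
    simp only [hD, Finset.mul_sum, Matrix.trace_sum, Matrix.mul_smul, Matrix.trace_smul,
      trace_logicalPauli_mul_logicalPauli_mul_proj]
    simp [mul_right_comm]
  have htr : D.trace = 1 := by
    have := hQ fun _ => (false, false)
    rwa [logicalPauli_one, one_mul, one_mul, hρ.2] at this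
  have hle := hDpos.trace_mul_self_le
  rw [htr] at hle
  have hDD : (D * D).trace = (2 ^ k : ℂ)⁻¹ * ∑ P, (C.logicalPauli P * ρ).trace ^ 2 := by
    have hpD : C.proj * D = D := by
      rw [hDl, ← mul_assoc, ← (C.lift_commute_proj ρ).eq, mul_assoc, C.proj_mul_self]
    nth_rewrite 1 [hDl]
    rw [mul_assoc, hpD, trace_lift_mul]
    simp_rw [hQ, sq]
  rw [hDD] at hle
  simp_rw [trace_mul_eq_expect (C.logicalPauli_isHermitian _) hρ.1.isHermitian] at hle
  have : ((2 : ℝ) ^ k)⁻¹ * ∑ P, expect (C.logicalPauli P) ρ ^ 2 ≤ 1 ^ 2 := by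
    refine Complex.real_le_real.1 ?_
    push_cast
    exact hle
  rw [inv_mul_le_iff₀ (by positivity)] at this
  simpa using this

/-- The effect of an outcome of the measurement of a logical Pauli operator. -/
theorem expect_half_smul (P : PauliLabel k) (b : Bool) (hρ : IsState ρ) :
    expect ((1 / 2 : ℂ) • (1 + (if b then (1 : ℂ) else -1) • C.logicalPauli P)) ρ =
      (1 + (if b then 1 else -1) * expect (C.logicalPauli P) ρ) / 2 := by
  have e1 : (1 / 2 : ℂ) = ((1 / 2 : ℝ) : ℂ) := by push_cast; rfl
  have e2 : (if b then (1 : ℂ) else -1) = ((if b then (1 : ℝ) else -1 : ℝ) : ℂ) := by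
    cases b <;> simp
  rw [e1, e2, expect_smul, expect_add, expect_smul, expect_one hρ]
  ring

theorem expect_half_smul_nonneg (P : PauliLabel k) (b : Bool) (hρ : IsState ρ) :
    0 ≤ expect ((1 / 2 : ℂ) • (1 + (if b then (1 : ℂ) else -1) • C.logicalPauli P)) ρ := by
  refine expect_nonneg (Matrix.IsHermitian.posSemidef_of_mul_self ?_ ?_) hρ
  · have := C.logicalPauli_isHermitian P
    cases b <;> simp [Matrix.IsHermitian, this.eq]
  · have := C.logicalPauli_mul_self P
    cases b <;> simp [mul_add, add_mul, this] <;> module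

end QubitCode

/-! ### The spectral gap of the verification operator -/

namespace VerificationStrategy

variable {n k M : ℕ} {C : QubitCode n k} (S : VerificationStrategy C M)

open scoped MatrixOrder in
theorem E_mul_proj (l : Fin M) : S.E l * C.proj = C.proj := by
  have hPos : C.proj.PosSemidef := C.proj_isHermitian.posSemidef_of_mul_self C.proj_mul_self
  have hc : (0 : ℂ) ≤ (2 ^ k)⁻¹ := by positivity
  -- The maximally mixed code state suffices: Tr((1 - E)𝒫) = 0 with 1 - E ≥ 0 forces (1 - E)𝒫 = 0.
  have h := S.pass_code l ((2 ^ k : ℂ)⁻¹ • C.proj)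
    ⟨hPos.smul hc, by
      rw [Matrix.trace_smul, C.trace_proj, smul_eq_mul, inv_mul_cancel₀ (by positivity)]⟩
    (by rw [mul_smul_comm, smul_mul_assoc, C.proj_mul_self, C.proj_mul_self])
  rw [mul_smul_comm, Matrix.trace_smul, smul_eq_mul, inv_mul_eq_iff_eq_mul₀ (by positivity),
    mul_one] at h
  obtain ⟨X, hX⟩ := CStarAlgebra.nonneg_iff_eq_star_mul_self.mp (S.E_le_one l).nonneg
  rw [Matrix.star_eq_conjTranspose] at hX
  have h0 : ((X * C.proj)ᴴ * (X * C.proj)).trace = 0 := by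
    calc _ = (C.proj * (1 - S.E l) * C.proj).trace := by
          rw [Matrix.conjTranspose_mul, C.proj_isHermitian.eq, hX]
          simp only [mul_assoc]
      _ = ((1 - S.E l) * C.proj).trace := by
          rw [Matrix.trace_mul_comm, ← mul_assoc, C.proj_mul_self, Matrix.trace_mul_comm]
      _ = 0 := by rw [sub_mul, one_mul, Matrix.trace_sub, h, C.trace_proj, sub_self]
  rw [Matrix.trace_conjTranspose_mul_self_eq_zero_iff] at h0
  have h1 : (1 - S.E l) * C.proj = 0 := by rw [hX, mul_assoc, h0, mul_zero]
  rw [sub_mul, one_mul, sub_eq_zero] at h1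
  exact h1.symm

theorem omega_mul_proj : S.omega * C.proj = C.proj := by
  simp_rw [omega, Finset.sum_mul, smul_mul_assoc, S.E_mul_proj, ← Finset.sum_smul]
  rw [← Complex.ofReal_sum, S.prob_sum]
  simp

theorem omega_posSemidef : S.omega.PosSemidef :=
  Matrix.posSemidef_sum _ fun l _ =>
    (S.E_nonneg l).smul (Complex.zero_le_real.2 (S.prob_nonneg l))

theorem one_sub_omega_posSemidef : (1 - S.omega).PosSemidef := by
  have : 1 - S.omega = ∑ l, (S.prob l : ℂ) • (1 - S.E l) := by
    simp_rw [smul_sub, Finset.sum_sub_distrib, ← Finset.sum_smul]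
    rw [← Complex.ofReal_sum, S.prob_sum, Complex.ofReal_one, one_smul, omega]
  rw [this]
  exact Matrix.posSemidef_sum _ fun l _ =>
    (S.E_le_one l).smul (Complex.zero_le_real.2 (S.prob_nonneg l))

theorem expect_omega (ρ : Op n) : expect S.omega ρ = ∑ l, S.prob l * expect (S.E l) ρ := by
  simp_rw [omega, expect_sum, expect_smul]

theorem star_mul_omega_mul :
    star (S.omega_isHermitian.eigenvectorUnitary : Op n) * S.omega *
      (S.omega_isHermitian.eigenvectorUnitary : Op n) =
      Matrix.diagonal fun i => (S.omega_isHermitian.eigenvalues i : ℂ) := by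
  have := S.omega_isHermitian.conjStarAlgAut_star_eigenvectorUnitary
  rwa [Unitary.conjStarAlgAut_star_apply] at this

theorem eigenvalues_le_one (i : Fin n → Fin 2) : S.omega_isHermitian.eigenvalues i ≤ 1 := by
  have h := (S.one_sub_omega_posSemidef.conjTranspose_mul_mul_same
    (S.omega_isHermitian.eigenvectorUnitary : Op n)).diag_nonneg (i := i)
  rw [← Matrix.star_eq_conjTranspose, mul_sub, sub_mul, star_mul_omega_mul, mul_one,
    Unitary.coe_star_mul_self] at h
  simp only [Matrix.sub_apply, Matrix.one_apply_eq, Matrix.diagonal_apply_eq, sub_nonneg] at h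
  exact_mod_cast h

theorem eigenvalue_mem_Icc (j : ℕ) (hj : j < 2 ^ n) : S.eigenvalue j hj ∈ Set.Icc 0 1 := by
  let e : Fin (Fintype.card (Fin n → Fin 2)) ≃ (Fin n → Fin 2) :=
    Fintype.equivOfCardEq (Fintype.card_fin _)
  have h : S.eigenvalue j hj = S.omega_isHermitian.eigenvalues (e ⟨j, by simpa using hj⟩) := by
    simp [eigenvalue, Matrix.IsHermitian.eigenvalues, e]
  rw [h]
  exact ⟨S.omega_posSemidef.eigenvalues_nonneg _, S.eigenvalues_le_one _⟩

theorem gapMin_le_one : S.gapMin ≤ 1 := by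
  have := (S.eigenvalue_mem_Icc (2 ^ k) (Nat.pow_lt_pow_right one_lt_two C.k_lt_n)).1
  unfold gapMin
  linarith

theorem gapMin_le_gapMax : S.gapMin ≤ S.gapMax := by
  have := S.omega_isHermitian.eigenvalues₀_antitone
    (a := ⟨2 ^ k, by simpa using Nat.pow_lt_pow_right one_lt_two C.k_lt_n⟩)
    (b := ⟨2 ^ n - 1, by simp⟩)
    (Fin.mk_le_mk.2 (Nat.le_sub_one_of_lt (Nat.pow_lt_pow_right one_lt_two C.k_lt_n)))
  unfold gapMin gapMax eigenvalue
  linarith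

theorem gapMax_nonneg : 0 ≤ S.gapMax := by
  have := (S.eigenvalue_mem_Icc (2 ^ n - 1) (Nat.sub_lt (by positivity) one_pos)).2
  unfold gapMax
  linarith

theorem gapMin_pos {τ : ℝ} (hτ : 0 < τ) (h : τ * S.gapMax < S.gapMin) : 0 < S.gapMin :=
  (mul_nonneg hτ.le S.gapMax_nonneg).trans_lt h

theorem one_lt_ratio {τ : ℝ} (hτ : 0 < τ) (h : τ * S.gapMax < S.gapMin) : 1 < S.ratio τ := by
  have := (S.gapMin_pos hτ h).trans_le S.gapMin_le_gapMax
  exact (one_lt_div (by positivity)).2 h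

/-- If the gap is positive, the eigenvectors for the `2 ^ k` largest eigenvalues span the code. -/
theorem star_mul_proj_mul (hgap : 0 < S.gapMin) :
    star (S.omega_isHermitian.eigenvectorUnitary : Op n) * C.proj *
      (S.omega_isHermitian.eigenvectorUnitary : Op n) =
      Matrix.diagonal fun i => if ((Fintype.equivOfCardEq (Fintype.card_fin _) :
        Fin (Fintype.card (Fin n → Fin 2)) ≃ (Fin n → Fin 2)).symm i : ℕ) < 2 ^ k
        then (1 : ℂ) else 0 := by
  set e : Fin (Fintype.card (Fin n → Fin 2)) ≃ (Fin n → Fin 2) :=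
    Fintype.equivOfCardEq (Fintype.card_fin _) with he
  set U : Op n := (S.omega_isHermitian.eigenvectorUnitary : Op n)
  have hUU : star U * U = 1 := Unitary.coe_star_mul_self _
  have hUU' : U * star U = 1 := Unitary.coe_mul_star_self _
  set Q := star U * C.proj * U with hQ
  set J : Op n := Matrix.diagonal fun i => if (e.symm i : ℕ) < 2 ^ k then (1 : ℂ) else 0 with hJ
  have hQH : Q.IsHermitian := by
    rw [hQ, Matrix.star_eq_conjTranspose]
    exact Matrix.isHermitian_conjTranspose_mul_mul U C.proj_isHermitian
  have hQQ : Q * Q = Q := by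
    calc Q * Q = star U * C.proj * (U * star U) * C.proj * U := by simp only [hQ, mul_assoc]
      _ = Q := by rw [hUU', mul_one, mul_assoc (star U), C.proj_mul_self]
  have hDQ : (Matrix.diagonal fun i => (S.omega_isHermitian.eigenvalues i : ℂ)) * Q = Q := by
    rw [← S.star_mul_omega_mul]
    calc _ = star U * S.omega * (U * star U) * C.proj * U := by simp only [hQ, U, mul_assoc]
      _ = Q := by rw [hUU', mul_one, mul_assoc (star U), S.omega_mul_proj]
  have hlt : ∀ i, ¬ (e.symm i : ℕ) < 2 ^ k → S.omega_isHermitian.eigenvalues i < 1 := by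
    intro i hi
    have := S.omega_isHermitian.eigenvalues₀_antitone
      (a := ⟨2 ^ k, by simpa using Nat.pow_lt_pow_right one_lt_two C.k_lt_n⟩) (b := e.symm i)
      (not_lt.1 hi)
    refine lt_of_le_of_lt this ?_
    unfold gapMin eigenvalue at hgap
    linarith
  -- Ω𝒫 = 𝒫 kills every row of `Q` whose eigenvalue is below 1, and by the gap these include all
  -- rows from position 2^k on.
  have hJQ : J * Q = Q := by
    ext i j
    rw [hJ, Matrix.diagonal_mul]
    split_ifs with hi
    · rw [one_mul]
    · have h1 := congrFun (congrFun hDQ i) j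
      rw [Matrix.diagonal_mul] at h1
      have h2 : ((S.omega_isHermitian.eigenvalues i : ℂ) - 1) * Q i j = 0 := by
        rw [sub_mul, h1, one_mul, sub_self]
      rcases mul_eq_zero.1 h2 with h3 | h3
      · exact absurd (by exact_mod_cast sub_eq_zero.1 h3) (hlt i hi).ne
      · rw [h3, mul_zero]
  have hJH : J.IsHermitian := by
    rw [hJ, Matrix.IsHermitian, Matrix.diagonal_conjTranspose]
    congr 1
    funext i
    simp only [Pi.star_apply]
    split_ifs <;> simp
  have hQJ : Q * J = Q := by
    have := congrArg Matrix.conjTranspose hJQ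
    rwa [Matrix.conjTranspose_mul, hQH.eq, hJH.eq] at this
  have hJJ : J * J = J := by
    rw [hJ, Matrix.diagonal_mul_diagonal]
    congr 1
    funext i
    split_ifs <;> simp
  -- `J - Q` is a projector of trace 2^k - 2^k = 0, so it vanishes.
  have hpos : (J - Q).PosSemidef := by
    refine (hJH.sub hQH).posSemidef_of_mul_self ?_
    rw [mul_sub, sub_mul, sub_mul, hJJ, hJQ, hQJ, hQQ, sub_self, sub_zero]
  have htJ : J.trace = 2 ^ k := by
    rw [hJ, Matrix.trace_diagonal, ← e.sum_comp]
    simp only [Equiv.symm_apply_apply]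
    rw [Fin.sum_univ_eq_sum_range (fun j => if j < 2 ^ k then (1 : ℂ) else 0), ← Finset.sum_filter]
    have : (Finset.range (Fintype.card (Fin n → Fin 2))).filter (· < 2 ^ k) =
        Finset.range (2 ^ k) := by
      ext j
      have := Nat.pow_lt_pow_right one_lt_two C.k_lt_n
      simp only [Fintype.card_pi, Fintype.card_fin, Finset.prod_const, Finset.card_univ,
        Finset.mem_filter, Finset.mem_range]
      omega
    rw [this]
    simp
  have htQ : Q.trace = 2 ^ k := by
    rw [hQ, Matrix.trace_mul_cycle, hUU', one_mul, C.trace_proj]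
  have h0 := hpos.trace_eq_zero_iff.1 (by rw [Matrix.trace_sub, htJ, htQ, sub_self])
  exact (sub_eq_zero.1 h0).symm

/-- In an eigenbasis of Ω the diagonal of `ρ` is a probability distribution. Eigenvalues are at most
1 on the code and at most 1 - Δ_min off it. -/
theorem expect_omega_le {ρ : Op n} (hρ : IsState ρ) (hgap : 0 < S.gapMin) :
    expect S.omega ρ ≤ 1 - S.gapMin * (1 - expect C.proj ρ) := by
  set e : Fin (Fintype.card (Fin n → Fin 2)) ≃ (Fin n → Fin 2) :=
    Fintype.equivOfCardEq (Fintype.card_fin _)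
  set U : Op n := (S.omega_isHermitian.eigenvectorUnitary : Op n)
  have hUU' : U * star U = 1 := Unitary.coe_mul_star_self _
  set σ := star U * ρ * U with hσ
  have hconj : ∀ A : Op n, expect A ρ = expect (star U * A * U) σ := by
    intro A
    unfold expect
    congr 1
    calc (A * ρ).trace = (A * (U * star U) * ρ * (U * star U)).trace := by
          rw [hUU', mul_one, mul_one]
      _ = _ := by
          rw [← mul_assoc _ U (star U), Matrix.trace_mul_comm]
          simp only [hσ, mul_assoc]
  have hpos : σ.PosSemidef := by
    have := hρ.1.conjTranspose_mul_mul_same U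
    rwa [← Matrix.star_eq_conjTranspose] at this
  have hd : ∀ i, 0 ≤ (σ i i).re := fun i => (Complex.le_def.1 (hpos.diag_nonneg (i := i))).1
  have htr : ∑ i, (σ i i).re = 1 := by
    have : σ.trace = 1 := by rw [hσ, Matrix.trace_mul_cycle, hUU', one_mul, hρ.2]
    have := congrArg Complex.re this
    simpa [Matrix.trace] using this
  have h1 : expect S.omega ρ = ∑ i, S.omega_isHermitian.eigenvalues i * (σ i i).re := by
    rw [hconj, S.star_mul_omega_mul, expect, Matrix.trace, Complex.re_sum]
    simp [Matrix.diagonal_mul]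
  have h2 : expect C.proj ρ = ∑ i, (if (e.symm i : ℕ) < 2 ^ k then 1 else 0) * (σ i i).re := by
    rw [hconj, S.star_mul_proj_mul hgap, expect, Matrix.trace, Complex.re_sum]
    refine Finset.sum_congr rfl fun i _ => ?_
    rw [Matrix.diag_apply, Matrix.diagonal_mul]
    split_ifs <;> simp
  rw [h1, h2]
  have h3 : ∀ i, S.omega_isHermitian.eigenvalues i ≤
      1 - S.gapMin + S.gapMin * (if (e.symm i : ℕ) < 2 ^ k then 1 else 0) := by
    intro i
    split_ifs with hi
    · have := S.eigenvalues_le_one i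
      linarith
    · have : S.omega_isHermitian.eigenvalues i ≤
          S.eigenvalue (2 ^ k) (Nat.pow_lt_pow_right one_lt_two C.k_lt_n) :=
        S.omega_isHermitian.eigenvalues₀_antitone
          (a := ⟨2 ^ k, by simpa using Nat.pow_lt_pow_right one_lt_two C.k_lt_n⟩)
          (b := e.symm i) (not_lt.1 hi)
      unfold gapMin
      linarith
  refine (Finset.sum_le_sum fun i _ => mul_le_mul_of_nonneg_right (h3 i) (hd i)).trans
    (le_of_eq ?_)
  simp_rw [add_mul, mul_assoc, Finset.sum_add_distrib, ← Finset.mul_sum, htr]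
  ring

/-! ### The verification step -/

/-- The probability of a choice of a measurement and its outcome. -/
noncomputable def testWeight (ρ : Op n) (b : Fin M × Bool) : ℝ :=
  S.prob b.1 * if b.2 then expect (S.E b.1) ρ else expect (1 - S.E b.1) ρ

theorem recordProb_eq (ρ : Op n) {N : ℕ} :
    S.recordProb ρ = fun a : VerifRecord M N => ∏ t, S.testWeight ρ (a t) := rfl

variable {ρ : Op n}

theorem testWeight_nonneg (hρ : IsState ρ) (b : Fin M × Bool) : 0 ≤ S.testWeight ρ b := by
  refine mul_nonneg (S.prob_nonneg _) ?_
  split_ifs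
  exacts [expect_nonneg (S.E_nonneg _) hρ, expect_nonneg (S.E_le_one _) hρ]

theorem sum_testWeight (hρ : IsState ρ) : ∑ b, S.testWeight ρ b = 1 := by
  rw [Fintype.sum_prod_type, ← S.prob_sum]
  refine Finset.sum_congr rfl fun l _ => ?_
  simp [testWeight, expect_sub, expect_one hρ]
  ring

theorem sum_testWeight_pass : ∑ b, S.testWeight ρ b * (if b.2 then 1 else 0) =
    expect S.omega ρ := by
  rw [Fintype.sum_prod_type, expect_omega]
  refine Finset.sum_congr rfl fun l _ => ?_
  simp [testWeight]

theorem numPass_eq_sum {N : ℕ} (a : VerifRecord M N) :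
    (numPass a : ℝ) = ∑ t, if (a t).2 then (1 : ℝ) else 0 := by
  simp [numPass]

variable {τ ε δ : ℝ}

theorem threshold_eq : S.threshold τ ε = balancedThreshold (S.ratio τ) (S.gapMin * ε) := rfl

theorem eventProb_pass_le (hρ : IsState ρ) (hε : 0 < ε) (hε1 : ε < 1) (hδ : 0 < δ)
    (hτ : 0 < τ) (hgap : τ * S.gapMax < S.gapMin) (hF : expect C.proj ρ ≤ 1 - ε) :
    eventProb (S.recordProb ρ)
      {a : VerifRecord M (S.numTests τ ε δ) |
        S.threshold τ ε * (S.numTests τ ε δ : ℝ) ≤ (numPass a : ℝ)} ≤ δ := by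
  have hg := S.gapMin_pos hτ hgap
  have hg1 := S.gapMin_le_one
  have hr := S.one_lt_ratio hτ hgap
  have he : 0 < S.gapMin * ε := by positivity
  have he1 : S.gapMin * ε < 1 := by nlinarith
  obtain ⟨-, hp1, hqp, -⟩ := balancedThreshold_bounds hr he he1
  have hD := klBernoulli_balancedThreshold_pos hr he he1
  simp_rw [numPass_eq_sum, recordProb_eq]
  refine (chernoff_bound (S.testWeight_nonneg hρ) (S.sum_testWeight hρ) Prod.snd
    (q := 1 - S.gapMin * ε) (by linarith) (by rw [threshold_eq]; exact hqp)
    (by rw [threshold_eq]; exact hp1) ?_ _).trans ?_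
  · rw [sum_testWeight_pass]
    refine (S.expect_omega_le hρ hg).trans ?_
    have := mul_le_mul_of_nonneg_left (show ε ≤ 1 - expect C.proj ρ by linarith) hg.le
    linarith
  · rw [threshold_eq, ← Real.le_log_iff_exp_le hδ, neg_le, ← Real.log_inv, ← one_div,
      ← div_le_iff₀ hD]
    exact Nat.le_ceil _

theorem numTests_le (hε : 0 < ε) (hε1 : ε < 1) (hδ : 0 < δ) (hδ1 : δ < 1 / 2)
    (hτ : 0 < τ) (hgap : τ * S.gapMax < S.gapMin) :
    (S.numTests τ ε δ : ℝ) ≤ (4 / (1 - 1 / √(S.ratio τ)) ^ 2 + 1 / Real.log 2) *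
      (Real.log (1 / δ) / (S.gapMin * ε)) := by
  have hg := S.gapMin_pos hτ hgap
  have hg1 := S.gapMin_le_one
  have hr := S.one_lt_ratio hτ hgap
  have he : 0 < S.gapMin * ε := by positivity
  have he1 : S.gapMin * ε < 1 := by nlinarith
  have hD := klBernoulli_balancedThreshold_ge hr he he1
  have hDpos := klBernoulli_balancedThreshold_pos hr he he1
  have hsq : 0 < (1 - 1 / √(S.ratio τ)) ^ 2 := by
    have : 1 / √(S.ratio τ) < 1 := by
      rw [div_lt_one (by positivity), Real.lt_sqrt zero_le_one]
      simpa
    have : 0 < 1 - 1 / √(S.ratio τ) := by linarith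
    positivity
  have hlog2 : 0 < Real.log 2 := Real.log_pos one_lt_two
  have hlog : Real.log 2 ≤ Real.log (1 / δ) :=
    Real.log_le_log two_pos (by rw [le_div_iff₀ hδ]; linarith)
  have hnn : 0 ≤ Real.log (1 / δ) := hlog2.le.trans hlog
  have h1 : Real.log (1 / δ) / klBernoulli (S.threshold τ ε) (1 - S.gapMin * ε) ≤
      4 / (1 - 1 / √(S.ratio τ)) ^ 2 * (Real.log (1 / δ) / (S.gapMin * ε)) := by
    rw [threshold_eq]
    refine (div_le_div_of_nonneg_left hnn (by positivity) hD).trans (le_of_eq ?_)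
    field_simp
  -- The unit lost to rounding is absorbed because ln(1/δ) ≥ ln 2 and Δ_min ε ≤ 1.
  have h2 : 1 ≤ 1 / Real.log 2 * (Real.log (1 / δ) / (S.gapMin * ε)) := by
    rw [div_mul_div_comm, one_mul, one_le_div (by positivity)]
    nlinarith
  refine (Nat.ceil_lt_add_one ?_).le.trans ?_
  · rw [threshold_eq]
    positivity
  · linarith

end VerificationStrategy

/-! ### The estimation step -/

namespace QubitCode

variable {n k : ℕ} (C : QubitCode n k) {ψ : (Fin n → Fin 2) → ℂ} {ρ : Op n} {δ ε : ℝ}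

theorem samplingProb_nonneg (ψ : (Fin n → Fin 2) → ℂ) (P : PauliLabel k) :
    0 ≤ C.samplingProb ψ P := by
  unfold samplingProb
  positivity

theorem sum_samplingProb (hψ : C.proj *ᵥ ψ = ψ) (h1 : star ψ ⬝ᵥ ψ = 1) :
    ∑ P, C.samplingProb ψ P = 1 := by
  simp_rw [samplingProb]
  rw [← Finset.sum_div, C.sum_expect_logicalPauli_sq hψ h1, div_self (by positivity)]

theorem abs_expect_logicalPauli_le (hρ : IsState ρ) (P : PauliLabel k) :
    -1 ≤ expect (C.logicalPauli P) ρ ∧ expect (C.logicalPauli P) ρ ≤ 1 := by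
  have ht := C.expect_half_smul_nonneg P true hρ
  have hf := C.expect_half_smul_nonneg P false hρ
  rw [expect_half_smul _ _ _ hρ] at ht hf
  simp only [if_true, Bool.false_eq_true, if_false] at ht hf
  constructor <;> linarith

/-- The probability of an outcome of the measurement of a logical Pauli operator. -/
noncomputable def outcomeWeight (ρ : Op n) (P : PauliLabel k) (b : Bool) : ℝ :=
  expect ((1 / 2 : ℂ) • (1 + (if b then (1 : ℂ) else -1) • C.logicalPauli P)) ρ

theorem sum_outcomeWeight (hρ : IsState ρ) (P : PauliLabel k) :
    ∑ b, C.outcomeWeight ρ P b = 1 := by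
  simp_rw [outcomeWeight, expect_half_smul _ _ _ hρ]
  simp
  ring

/-- A sampled logical Pauli operator together with the outcomes of its measurements. -/
abbrev Sample (ψ : (Fin n → Fin 2) → ℂ) (δ : ℝ) : Type :=
  (P : PauliLabel k) × (Fin (C.numShots ψ δ P) → Bool)

/-- The probability of a sample. -/
noncomputable def sampleWeight (ψ : (Fin n → Fin 2) → ℂ) (ρ : Op n) (b : C.Sample ψ δ) : ℝ :=
  C.samplingProb ψ b.1 * ∏ j, C.outcomeWeight ρ b.1 (b.2 j)

theorem dfeProb_eq {l : ℕ} :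
    C.dfeProb ψ ρ = fun b : C.DfeRecord ψ δ l => ∏ i, C.sampleWeight ψ ρ (b i) := rfl

theorem sampleWeight_nonneg (hρ : IsState ρ) (b : C.Sample ψ δ) : 0 ≤ C.sampleWeight ψ ρ b :=
  mul_nonneg (C.samplingProb_nonneg ψ _)
    (Finset.prod_nonneg fun _ _ => C.expect_half_smul_nonneg _ _ hρ)

theorem sum_sampleWeight_mul_fst (hρ : IsState ρ) (f : PauliLabel k → ℝ) :
    ∑ b : C.Sample ψ δ, C.sampleWeight ψ ρ b * f b.1 = ∑ P, C.samplingProb ψ P * f P := by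
  rw [Fintype.sum_sigma]
  refine Finset.sum_congr rfl fun P _ => ?_
  simp only [sampleWeight]
  rw [← Finset.sum_mul, ← Finset.mul_sum, sum_prod_weights (C.sum_outcomeWeight hρ P), mul_one]

theorem sum_sampleWeight (hψ : C.proj *ᵥ ψ = ψ) (h1 : star ψ ⬝ᵥ ψ = 1) (hρ : IsState ρ) :
    ∑ b : C.Sample ψ δ, C.sampleWeight ψ ρ b = 1 := by
  have := C.sum_sampleWeight_mul_fst (ψ := ψ) (δ := δ) hρ fun _ => 1
  simpa [C.sum_samplingProb hψ h1] using this

/-- The ratio of the expectations of a logical Pauli operator in `ρ` and in `ψ`. -/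
noncomputable def pauliRatio (ψ : (Fin n → Fin 2) → ℂ) (ρ : Op n) (P : PauliLabel k) : ℝ :=
  expect (C.logicalPauli P) ρ / expect (C.logicalPauli P) (ketbra ψ)

theorem sum_samplingProb_mul_pauliRatio :
    ∑ P, C.samplingProb ψ P * C.pauliRatio ψ ρ P =
      (∑ P, expect (C.logicalPauli P) (ketbra ψ) * expect (C.logicalPauli P) ρ) / 2 ^ k := by
  rw [Finset.sum_div]
  refine Finset.sum_congr rfl fun P _ => ?_
  unfold samplingProb pauliRatio
  -- A Pauli with zero expectation in `ψ` has sampling probability 0 and, as division by zero yields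
  -- 0, ratio 0.
  by_cases h : expect (C.logicalPauli P) (ketbra ψ) = 0
  · simp [h]
  · field_simp

theorem sum_samplingProb_mul_pauliRatio_sq_le (hρ : IsState ρ) :
    ∑ P, C.samplingProb ψ P * C.pauliRatio ψ ρ P ^ 2 ≤ 1 := by
  have h := C.sum_expect_logicalPauli_sq_le hρ
  rw [← div_le_one (by positivity), Finset.sum_div] at h
  refine (Finset.sum_le_sum fun P _ => ?_).trans h
  unfold samplingProb pauliRatio
  by_cases h : expect (C.logicalPauli P) (ketbra ψ) = 0
  · simp only [h]
    simp
    positivity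
  · exact le_of_eq (by field_simp)

/-- The shot number is inversely proportional to the squared expectation, which makes the
sub-Gaussian bound on the shot noise the same for every sampled Pauli. -/
theorem sq_mul_numShots_ge (hδ : 0 < δ) (hδ1 : δ < 1 / 2) {P : PauliLabel k}
    (hP : expect (C.logicalPauli P) (ketbra ψ) ≠ 0) :
    δ * Real.log (4 / δ) ≤
      expect (C.logicalPauli P) (ketbra ψ) ^ 2 * (C.numShots ψ δ P : ℝ) ∧
    0 < (C.numShots ψ δ P : ℝ) := by
  have hlog : 0 < Real.log (4 / δ) := Real.log_pos (by rw [lt_div_iff₀ hδ]; linarith)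
  have hc : 0 < expect (C.logicalPauli P) (ketbra ψ) ^ 2 := by positivity
  have h : δ * Real.log (4 / δ) / expect (C.logicalPauli P) (ketbra ψ) ^ 2 ≤
      (C.numShots ψ δ P : ℝ) := by
    unfold numShots samplingProb
    rw [mul_div_cancel₀ _ (by positivity)]
    exact Nat.le_ceil _
  exact ⟨by rwa [div_le_iff₀' hc] at h, lt_of_lt_of_le (by positivity) h⟩

/-- The contribution of a sample to the estimator. -/
noncomputable def sampleValue (b : C.Sample ψ δ) : ℝ :=
  1 / expect (C.logicalPauli b.1) (ketbra ψ) *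
    (1 / (C.numShots ψ δ b.1 : ℝ) * ∑ j, if b.2 j then (1 : ℝ) else -1)

theorem estimator_eq {l : ℕ} (b : C.DfeRecord ψ δ l) :
    C.estimator ψ b = 1 / (l : ℝ) * ∑ i, C.sampleValue (b i) := rfl

theorem sum_outcomeWeight_mul_exp_le (hρ : IsState ρ) (P : PauliLabel k) (s : ℝ) :
    ∑ b, C.outcomeWeight ρ P b *
      Real.exp (s * ((if b then 1 else -1) - expect (C.logicalPauli P) ρ)) ≤
      Real.exp (s ^ 2 / 2) := by
  obtain ⟨h1, h2⟩ := C.abs_expect_logicalPauli_le hρ P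
  refine le_trans (le_of_eq ?_) (hoeffding_two_point h1 h2 s)
  simp_rw [outcomeWeight, expect_half_smul _ _ _ hρ]
  simp
  ring

/-- The moment generating function of the shot noise of a sample. -/
theorem sum_sampleWeight_mul_exp_le (hψ : C.proj *ᵥ ψ = ψ) (h1 : star ψ ⬝ᵥ ψ = 1)
    (hρ : IsState ρ) (hδ : 0 < δ) (hδ1 : δ < 1 / 2) (s : ℝ) :
    ∑ b : C.Sample ψ δ, C.sampleWeight ψ ρ b *
      Real.exp (s * (C.sampleValue b - C.pauliRatio ψ ρ b.1)) ≤
      Real.exp (s ^ 2 / (2 * (δ * Real.log (4 / δ)))) := by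
  have hlog : 0 < Real.log (4 / δ) := Real.log_pos (by rw [lt_div_iff₀ hδ]; linarith)
  rw [Fintype.sum_sigma, ← one_mul (Real.exp (s ^ 2 / _)), ← C.sum_samplingProb hψ h1,
    Finset.sum_mul]
  refine Finset.sum_le_sum fun P _ => ?_
  simp only [sampleWeight, mul_assoc]
  rw [← Finset.mul_sum]
  by_cases hP : expect (C.logicalPauli P) (ketbra ψ) = 0
  · simp [samplingProb, hP]
  refine mul_le_mul_of_nonneg_left ?_ (C.samplingProb_nonneg ψ P)
  obtain ⟨hcm, hm⟩ := C.sq_mul_numShots_ge hδ hδ1 hP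
  set c := expect (C.logicalPauli P) (ketbra ψ) with hc
  set m := C.numShots ψ δ P with hm_def
  set x := expect (C.logicalPauli P) ρ with hx
  -- For a fixed Pauli, the noise is a sum of `m` independent centred outcomes scaled by 1/(cm).
  have hval : ∀ a : Fin m → Bool,
      s * (C.sampleValue (⟨P, a⟩ : C.Sample ψ δ) - C.pauliRatio ψ ρ P) =
        s / (c * m) * ∑ j, ((if a j then (1 : ℝ) else -1) - x) := by
    intro a
    rw [Finset.sum_sub_distrib, Finset.sum_const, Finset.card_univ, Fintype.card_fin,
      nsmul_eq_mul, sampleValue, pauliRatio, ← hc, ← hx]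
    change s * (1 / c * (1 / (m : ℝ) * ∑ j, if a j then (1 : ℝ) else -1) - x / c) = _
    field_simp
  simp_rw [hval]
  have := sum_prod_weights_mul_exp (w := C.outcomeWeight ρ P) m
    (fun b => (if b then (1 : ℝ) else -1) - x) (s / (c * m))
  rw [this]
  refine (pow_le_pow_left₀ (Finset.sum_nonneg fun b _ =>
    mul_nonneg (C.expect_half_smul_nonneg P b hρ) (Real.exp_pos _).le)
    (C.sum_outcomeWeight_mul_exp_le hρ P _) m).trans ?_
  rw [← Real.exp_nat_mul, Real.exp_le_exp]
  have e : (m : ℝ) * ((s / (c * m)) ^ 2 / 2) = s ^ 2 / (2 * (c ^ 2 * m)) := by field_simp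
  rw [e]
  exact div_le_div_of_nonneg_left (sq_nonneg s) (by positivity) (by linarith)

theorem numPaulis_ge (hε : 0 < ε) (hδ : 0 < δ) : 8 ≤ (numPaulis ε δ : ℝ) * (ε ^ 2 * δ) := by
  rw [← div_le_iff₀ (by positivity)]
  exact Nat.le_ceil _

theorem eventProb_estimator_le (hψ : C.proj *ᵥ ψ = ψ) (h1 : star ψ ⬝ᵥ ψ = 1) (hρ : IsState ρ)
    (hε : 0 < ε) (hδ : 0 < δ) (hδ1 : δ < 1 / 2) (hF : 1 - ε < expect C.proj ρ) :
    eventProb (C.dfeProb ψ ρ) {b : C.DfeRecord ψ δ (numPaulis ε δ) |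
      expect (ketbra ψ) ρ ≤ C.estimator ψ b - 2 * ε} ≤ δ := by
  have hL := numPaulis_ge hε hδ
  set L := numPaulis ε δ with hL_def
  have hL0 : 0 < (L : ℝ) := by
    by_contra h
    have : (L : ℝ) * (ε ^ 2 * δ) ≤ 0 := mul_nonpos_of_nonpos_of_nonneg (not_lt.1 h) (by positivity)
    linarith
  have hw := C.sampleWeight_nonneg (ψ := ψ) (δ := δ) hρ
  have hw1 := C.sum_sampleWeight (δ := δ) hψ h1 hρ
  set μ := ∑ P, C.samplingProb ψ P * C.pauliRatio ψ ρ P with hμ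
  have hμF : μ < expect (ketbra ψ) ρ + ε := by
    have := C.sum_expect_mul_expect_le hψ h1 hρ
    rw [← sum_samplingProb_mul_pauliRatio] at this
    linarith
  rw [dfeProb_eq]
  have hsub : {b : C.DfeRecord ψ δ L | expect (ketbra ψ) ρ ≤ C.estimator ψ b - 2 * ε} ⊆
      {b | L * (ε / 2) ≤ ∑ i, (C.pauliRatio ψ ρ (b i).1 - μ)} ∪
      {b | L * (ε / 2) ≤ ∑ i, (C.sampleValue (b i) - C.pauliRatio ψ ρ (b i).1)} := by
    intro b hb
    by_contra hcon
    simp only [Set.mem_union, Set.mem_ofPred_eq, not_or, not_le, Finset.sum_sub_distrib,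
      Finset.sum_const, Finset.card_univ, Fintype.card_fin, nsmul_eq_mul] at hcon hb
    rw [estimator_eq, one_div, ← div_eq_inv_mul] at hb
    -- One ε of the margin pays for the bias of `μ`; the other is shared equally by the two
    -- fluctuations.
    have h3 : μ + ε ≤ (∑ i, C.sampleValue (b i)) / L := by linarith
    rw [le_div_iff₀ hL0] at h3
    linarith [hcon.1, hcon.2]
  refine (eventProb_mono (fun b => Finset.prod_nonneg fun i _ => hw _) hsub).trans
    ((eventProb_union_le (fun b => Finset.prod_nonneg fun i _ => hw _) _ _).trans ?_)
  have hA : eventProb (fun b : C.DfeRecord ψ δ L => ∏ i, C.sampleWeight ψ ρ (b i))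
      {b | L * (ε / 2) ≤ ∑ i, (C.pauliRatio ψ ρ (b i).1 - μ)} ≤ δ / 2 := by
    have hmean : ∑ b : C.Sample ψ δ, C.sampleWeight ψ ρ b * (C.pauliRatio ψ ρ b.1 - μ) = 0 := by
      simp_rw [mul_sub, Finset.sum_sub_distrib, ← Finset.sum_mul]
      rw [hw1, C.sum_sampleWeight_mul_fst hρ (C.pauliRatio ψ ρ), one_mul, sub_self]
    have hvar : ∑ b : C.Sample ψ δ, C.sampleWeight ψ ρ b * (C.pauliRatio ψ ρ b.1 - μ) ^ 2 ≤ 1 := by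
      have h2 := C.sum_sampleWeight_mul_fst (ψ := ψ) (δ := δ) hρ fun P => C.pauliRatio ψ ρ P ^ 2
      have h3 : ∀ b : C.Sample ψ δ, C.sampleWeight ψ ρ b * (C.pauliRatio ψ ρ b.1 - μ) ^ 2 =
          C.sampleWeight ψ ρ b * C.pauliRatio ψ ρ b.1 ^ 2 -
          2 * μ * (C.sampleWeight ψ ρ b * (C.pauliRatio ψ ρ b.1 - μ)) -
          μ ^ 2 * C.sampleWeight ψ ρ b := fun b => by ring
      simp_rw [h3, Finset.sum_sub_distrib, ← Finset.mul_sum]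
      rw [hmean, h2, hw1]
      have := C.sum_samplingProb_mul_pauliRatio_sq_le (ψ := ψ) hρ
      nlinarith [sq_nonneg μ]
    -- Chebyshev gives 4/(Lε²), which is at most δ/2 because Lε²δ ≥ 8.
    refine (eventProb_sum_ge_le_variance hw hw1 L hmean (by positivity)).trans ?_
    rw [div_le_iff₀ (by positivity)]
    calc (L : ℝ) * _ ≤ L * 1 := mul_le_mul_of_nonneg_left hvar hL0.le
      _ ≤ δ / 2 * (L * (ε / 2)) ^ 2 := by nlinarith [mul_le_mul_of_nonneg_left hL hL0.le]
  have hB : eventProb (fun b : C.DfeRecord ψ δ L => ∏ i, C.sampleWeight ψ ρ (b i))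
      {b | L * (ε / 2) ≤ ∑ i, (C.sampleValue (b i) - C.pauliRatio ψ ρ (b i).1)} ≤ δ / 4 := by
    have hlog : 0 < Real.log (4 / δ) := Real.log_pos (by rw [lt_div_iff₀ hδ]; linarith)
    set K := δ * Real.log (4 / δ) with hK
    have hKpos : 0 < K := by positivity
    -- This `s` minimizes -sε/2 + s²/(2K), with minimum -Kε²/8. Summed over L samples the exponent
    -- is at most -ln(4/δ).
    refine (eventProb_sum_ge_le_exp hw L
      (fun b => C.sampleValue b - C.pauliRatio ψ ρ b.1) (s := K * ε / 2) (by positivity) _).trans ?_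
    refine (mul_le_mul_of_nonneg_left (pow_le_pow_left₀ (Finset.sum_nonneg fun b _ =>
      mul_nonneg (hw b) (Real.exp_pos _).le)
      (C.sum_sampleWeight_mul_exp_le hψ h1 hρ hδ hδ1 _) L) (Real.exp_pos _).le).trans ?_
    rw [← Real.exp_nat_mul, ← Real.exp_add, ← Real.le_log_iff_exp_le (by positivity),
      ← inv_div 4 δ, Real.log_inv, ← hK]
    have e : -(K * ε / 2 * (L * (ε / 2))) + L * ((K * ε / 2) ^ 2 / (2 * K)) =
        -(L * (ε ^ 2 * δ) / 8 * Real.log (4 / δ)) := by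
      field_simp
      rw [hK]
      ring
    rw [e, neg_le_neg_iff]
    exact le_mul_of_one_le_left hlog.le (by linarith)
  linarith

theorem sum_dfeProb_mul_dfeSamples_le (hψ : C.proj *ᵥ ψ = ψ) (h1 : star ψ ⬝ᵥ ψ = 1)
    (hρ : IsState ρ) (hε : 0 < ε) (hε1 : ε < 1) (hδ : 0 < δ) (hδ1 : δ < 1 / 2) :
    ∑ b : C.DfeRecord ψ δ (numPaulis ε δ), C.dfeProb ψ ρ b * (C.dfeSamples ψ b : ℝ) ≤
      27 * (1 / (ε ^ 2 * δ) + 2 ^ k * Real.log (1 / δ) / ε ^ 2) := by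
  have hw1 := C.sum_sampleWeight (δ := δ) hψ h1 hρ
  have hlog : 0 < Real.log (4 / δ) := Real.log_pos (by rw [lt_div_iff₀ hδ]; linarith)
  have hlog4 : Real.log (4 / δ) ≤ 3 * Real.log (1 / δ) := by
    have h2 : Real.log 2 ≤ Real.log (1 / δ) :=
      Real.log_le_log two_pos (by rw [le_div_iff₀ hδ]; linarith)
    rw [show 4 / δ = 2 ^ 2 * (1 / δ) by ring, Real.log_mul (by norm_num) (by positivity),
      Real.log_pow]
    push_cast
    linarith
  have hshots : ∑ P, C.samplingProb ψ P * (C.numShots ψ δ P : ℝ) ≤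
      1 + 2 ^ k * (δ * Real.log (4 / δ)) := by
    -- The probability cancels against the shot number; the first term accounts for rounding up.
    have hP : ∀ P, C.samplingProb ψ P * (C.numShots ψ δ P : ℝ) ≤
        C.samplingProb ψ P + δ * Real.log (4 / δ) / 2 ^ k := by
      intro P
      have h0 := C.samplingProb_nonneg ψ P
      have hm : (C.numShots ψ δ P : ℝ) ≤
          δ * Real.log (4 / δ) / (2 ^ k * C.samplingProb ψ P) + 1 :=
        (Nat.ceil_lt_add_one (by positivity)).le
      refine (mul_le_mul_of_nonneg_left hm h0).trans ?_
      rw [mul_add, mul_one, add_comm, add_le_add_iff_left]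
      rcases h0.eq_or_lt with h | h
      · rw [← h, zero_mul]
        positivity
      · exact le_of_eq (by field_simp)
    refine (Finset.sum_le_sum fun P _ => hP P).trans (le_of_eq ?_)
    rw [Finset.sum_add_distrib, C.sum_samplingProb hψ h1, Finset.sum_const, Finset.card_univ]
    simp only [Fintype.card_pi, Fintype.card_prod, Fintype.card_bool, Finset.prod_const,
      Finset.card_univ, Fintype.card_fin, nsmul_eq_mul]
    have h4 : (4 : ℝ) ^ k = 2 ^ k * 2 ^ k := by
      rw [← mul_pow]
      norm_num
    norm_num [h4]
    field_simp
  have hL : (numPaulis ε δ : ℝ) ≤ 9 / (ε ^ 2 * δ) := by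
    -- As ε²δ < 1, rounding up turns the constant 8 into 9; with the factor 3 from ln(4/δ) ≤ 3
    -- ln(1/δ) this makes 27.
    have h9 : 1 ≤ 1 / (ε ^ 2 * δ) := by
      rw [one_le_div (by positivity)]
      nlinarith [mul_pos hε hδ, mul_pos hε hε]
    have := (Nat.ceil_lt_add_one (a := 8 / (ε ^ 2 * δ)) (by positivity)).le
    calc (numPaulis ε δ : ℝ) ≤ 8 / (ε ^ 2 * δ) + 1 := this
      _ ≤ 8 / (ε ^ 2 * δ) + 1 / (ε ^ 2 * δ) := by linarith
      _ = _ := by ring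
  have hE : ∑ b : C.DfeRecord ψ δ (numPaulis ε δ), C.dfeProb ψ ρ b * (C.dfeSamples ψ b : ℝ) =
      numPaulis ε δ * ∑ P, C.samplingProb ψ P * (C.numShots ψ δ P : ℝ) := by
    rw [← C.sum_sampleWeight_mul_fst (δ := δ) hρ fun P => (C.numShots ψ δ P : ℝ),
      ← sum_prod_weights_mul_sum hw1]
    refine Finset.sum_congr rfl fun b _ => ?_
    rw [dfeSamples]
    push_cast
    rfl
  rw [hE]
  calc _ ≤ 9 / (ε ^ 2 * δ) * (1 + 2 ^ k * (δ * (3 * Real.log (1 / δ)))) := by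
        refine mul_le_mul hL (hshots.trans ?_) (Finset.sum_nonneg fun P _ =>
          mul_nonneg (C.samplingProb_nonneg ψ P) (Nat.cast_nonneg _)) (by positivity)
        gcongr
    _ = 9 * (1 / (ε ^ 2 * δ)) + 27 * (2 ^ k * Real.log (1 / δ) / ε ^ 2) := by
        field_simp
        ring
    _ ≤ _ := by
        have : 0 ≤ 1 / (ε ^ 2 * δ) := by positivity
        linarith

end QubitCode

/-! ### Combination of the two steps -/

theorem theorem2 :
    ∃ (c₁ : ℝ → ℝ) (c₂ : ℝ),
      ∀ (n k M : ℕ) (C : QubitCode n k) (S : VerificationStrategy C M)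
        (ψ : (Fin n → Fin 2) → ℂ) (ρ : Op n) (τ ε δ : ℝ),
        C.proj *ᵥ ψ = ψ → star ψ ⬝ᵥ ψ = 1 → IsState ρ →
        0 < ε → ε < 1 → 0 < δ → δ < 1 / 2 → 0 < τ → τ * S.gapMax < S.gapMin →
        -- the outcomes of the protocol follow a probability distribution
        (∀ ω : ProtocolRecord S ψ τ ε δ, 0 ≤ protocolProb S ψ ρ ω) ∧
        (∑ ω : ProtocolRecord S ψ τ ε δ, protocolProb S ψ ρ ω) = 1 ∧
        -- passing while the fidelity is at most `Y - 2 ε` has probability at most `2 δ`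
        eventProb (protocolProb S ψ ρ)
            {ω : ProtocolRecord S ψ τ ε δ |
              S.threshold τ ε * (S.numTests τ ε δ : ℝ) ≤ (numPass ω.1 : ℝ) ∧
              expect (ketbra ψ) ρ ≤ C.estimator ψ ω.2 - 2 * ε} ≤ 2 * δ ∧
        -- the number of samples of the first step
        (S.numTests τ ε δ : ℝ) ≤ c₁ (S.ratio τ) * (Real.log (1 / δ) / (S.gapMin * ε)) ∧
        -- the expected number of samples of the second step
        (∑ ω : ProtocolRecord S ψ τ ε δ, protocolProb S ψ ρ ω * (C.dfeSamples ψ ω.2 : ℝ)) ≤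
          c₂ * (1 / (ε ^ 2 * δ) + 2 ^ k * Real.log (1 / δ) / ε ^ 2) := by
  refine ⟨fun r => 4 / (1 - 1 / √r) ^ 2 + 1 / Real.log 2, 27, ?_⟩
  intro n k M C S ψ ρ τ ε δ hψ h1 hρ hε hε1 hδ hδ1 hτ hgap
  have hR0 : ∀ a : VerifRecord M (S.numTests τ ε δ), 0 ≤ S.recordProb ρ a :=
    fun a => Finset.prod_nonneg fun t _ => S.testWeight_nonneg hρ _
  have hR1 : ∑ a : VerifRecord M (S.numTests τ ε δ), S.recordProb ρ a = 1 :=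
    sum_prod_weights (S.sum_testWeight hρ) _
  have hD0 : ∀ b : C.DfeRecord ψ δ (numPaulis ε δ), 0 ≤ C.dfeProb ψ ρ b :=
    fun b => Finset.prod_nonneg fun t _ => C.sampleWeight_nonneg hρ _
  have hD1 : ∑ b : C.DfeRecord ψ δ (numPaulis ε δ), C.dfeProb ψ ρ b = 1 :=
    sum_prod_weights (C.sum_sampleWeight hψ h1 hρ) _
  have h0 : ∀ ω : ProtocolRecord S ψ τ ε δ, 0 ≤ protocolProb S ψ ρ ω :=
    fun ω => mul_nonneg (hR0 _) (hD0 _)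
  refine ⟨h0, ?_, ?_, S.numTests_le hε hε1 hδ hδ1 hτ hgap, ?_⟩
  · rw [Fintype.sum_prod_type]
    simp_rw [protocolProb, ← Finset.mul_sum, hD1, mul_one]
    exact hR1
  · refine le_trans ?_ (show δ ≤ 2 * δ by linarith)
    -- The two alternatives concern the fixed state, not the outcomes, so their bounds need not be
    -- added.
    rcases le_or_gt (expect C.proj ρ) (1 - ε) with hF | hF
    · refine le_trans ?_ (S.eventProb_pass_le hρ hε hε1 hδ hτ hgap hF)
      rw [← eventProb_mul_fst (w := S.recordProb ρ) hD1]
      exact eventProb_mono h0 fun ω hω => hω.1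
    · refine le_trans ?_ (C.eventProb_estimator_le hψ h1 hρ hε hδ hδ1 hF)
      rw [← eventProb_mul_snd (v := C.dfeProb ψ ρ) hR1]
      exact eventProb_mono h0 fun ω hω => hω.2
  · refine le_trans (le_of_eq ?_) (C.sum_dfeProb_mul_dfeSamples_le hψ h1 hρ hε hε1 hδ hδ1)
    rw [Fintype.sum_prod_type_right]
    refine Finset.sum_congr rfl fun b _ => ?_
    simp_rw [protocolProb, mul_assoc]
    rw [← Finset.sum_mul, hR1, one_mul]
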